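/- **Lemma 2.2 (Radial Sobolev-type inequalities in Besov spaces).** Fix a radial function $\varphi\in C^\infty(\mathbb R^5)$ with $\varphi(\xi)=1$ for $|\xi|\le 1$ and $\varphi(\xi)=0$ for $|\xi|>2$. With $\widehat f(\xi)=(2\pi)^{-5/2}\int_{\mathbb R^5} f(x)e^{-ix\cdot\xi}\,dx$, extended to tempered distributions, let $\widehat{P_jf}(\xi)=\big(\varphi(2^{-j}\xi)-\varphi(2^{-(j-1)}\xi)\big)\widehat f(\xi)$ for $j\in\mathbb Z$, and for $s\in\mathbb R$, $1\le p,r\le\infty$ let $$\|f\|_{\dot B^s_{p,r}}=\Big\|\big\{2^{js}\|P_jf\|_{L^p(\mathbb R^5)}\big\}_{j\in\mathbb Z}\Big\|_{\ell^r(\mathbb Z)} .$$ The space $\dot B^s_{p,r}(\mathbb R^5)$ is the completion of the Schwartz functions under this norm; for $s<5/p$ it is realized as the space of the tempered distributions $u$ with $\|u\|_{\dot B^s_{p,r}}<\infty$ for which there are Schwartz functions $f_n$ with $f_n\to u$ in $\mathcal S'(\mathbb R^5)$ and $\|u-f_n\|_{\dot B^s_{p,r}}\to0$. Functions are complex-valued,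 and $\partial_r f(x)=\frac{x}{|x|}\cdot\nabla f(x)$, $\partial_{rr}=\partial_r\partial_r$, with weak gradients on $\mathbb R^5$. There is a constant $C$, depending only on $\varphi$, such that the following hold. 1. For every radial $f\in\mathcal S(\mathbb R^5)$, $$\big\||x|^2f\big\|_{L^\infty(\mathbb R^5)}\le C\,\|f\|_{\dot B^{1/2}_{2,1}(\mathbb R^5)} .$$ 2. Every radial $u_0\in\dot B^3_{1,1}(\mathbb R^5)$ is a locally integrable function, $u_0$ and $\partial_ru_0$ have locally integrable weak gradients, and $$\Big\|\tfrac1{|x|^2}\partial_ru_0\Big\|_{L^1(\mathbb R^5)}+\Big\|\tfrac1{|x|}\partial_{rr}u_0\Big\|_{L^1(\mathbb R^5)}+\Big\|\tfrac1{|x|^3}u_0\Big\|_{L^1(\mathbb R^5)}+\big\||x|^3\partial_ru_0\big\|_{L^\infty(\mathbb R^5)}\le C\,\|u_0\|_{\dot B^3_{1,1}(\mathbb R^5)} .$$ 3. Every radial $u_1\in\dot B^2_{1,1}(\mathbb R^5)$ is a locally integrable function with locally integrable weak gradient, and $$\Big\|\tfrac1{|x|}\partial_ru_1\Big\|_{L^1(\mathbb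 R^5)}+\Big\|\tfrac1{|x|^2}u_1\Big\|_{L^1(\mathbb R^5)}+\big\||x|^3u_1\big\|_{L^\infty(\mathbb R^5)}\le C\,\|u_1\|_{\dot B^2_{1,1}(\mathbb R^5)} .$$ -/

import Mathlib

open MeasureTheory Filter Topology
open scoped ENNReal NNReal SchwartzMap ContDiff

noncomputable section

/-- `ℝ^d` with its Euclidean norm. -/
abbrev Eucl (d : ℕ) : Type := EuclideanSpace ℝ (Fin d)

/-- A function on `ℝ^d` is radial if its value at `x` depends only on `|x|`. -/
def IsRadialFun {d : ℕ} {α : Type*} (f : Eucl d → α) : Prop :=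
  ∀ x y : Eucl d, ‖x‖ = ‖y‖ → f x = f y

/-- A tempered distribution is radial if it is invariant under every linear isometry of `ℝ^d`. -/
def IsRadialDistribution {d : ℕ} (u : 𝓢'(Eucl d, ℂ)) : Prop :=
  ∀ (A : Eucl d ≃ₗᵢ[ℝ] Eucl d) (ψ : 𝓢(Eucl d, ℂ)),
    u (SchwartzMap.compCLMOfContinuousLinearEquiv ℂ A.toContinuousLinearEquiv ψ) = u ψ

/-- The cutoff that generates the Littlewood-Paley projections: smooth, radial, supported in
`|ξ| ≤ 2` and equal to `1` on `|ξ| ≤ 1`. -/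
structure IsLPCutoff {d : ℕ} (φ : Eucl d → ℂ) : Prop where
  smooth : ContDiff ℝ ∞ φ
  radial : IsRadialFun φ
  eq_one : ∀ ξ, ‖ξ‖ ≤ 1 → φ ξ = 1
  eq_zero : ∀ ξ, 2 < ‖ξ‖ → φ ξ = 0

/-- The Littlewood-Paley projection `P_j`, the Fourier multiplier with symbol
`φ(ξ / 2^j) - φ(ξ / 2^(j-1))`. The symbol is written in the frequency variable of the transform
with kernel `exp(-i x·ξ)`; Mathlib's kernel is `exp(-2πi x·η)`, whence `ξ = 2π η`. -/
def lpProj {d : ℕ} (φ : Eucl d → ℂ) (j : ℤ) (u : 𝓢'(Eucl d, ℂ)) : 𝓢'(Eucl d, ℂ) :=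
  TemperedDistribution.fourierMultiplierCLM ℂ
    (fun η : Eucl d => φ ((2 * Real.pi / (2 : ℝ) ^ j) • η)
      - φ ((2 * Real.pi / (2 : ℝ) ^ (j - 1)) • η)) u

/-- The `L^p` norm of a tempered distribution: the `L^p` norm of the (unique) `L^p` function which
represents it, and `∞` if there is none. -/
def distLpNorm {d : ℕ} (p : ℝ≥0∞) [Fact (1 ≤ p)] (u : 𝓢'(Eucl d, ℂ)) : ℝ≥0∞ :=
  ⨅ (g : Lp ℂ p (volume : Measure (Eucl d)))
    (_ : MeasureTheory.Lp.toTemperedDistribution g = u), ‖g‖ₑ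

/-- The homogeneous Besov norm: the `ℓ^r(ℤ)` norm of the sequence `2^(js) ‖P_j u‖_{L^p}`. -/
def besovNorm {d : ℕ} (φ : Eucl d → ℂ) (s : ℝ) (p r : ℝ≥0∞) [Fact (1 ≤ p)]
    (u : 𝓢'(Eucl d, ℂ)) : ℝ≥0∞ :=
  eLpNorm (fun j : ℤ => (2 : ℝ≥0∞) ^ ((j : ℝ) * s) * distLpNorm p (lpProj φ j u)) r
    Measure.count

/-- Membership in the homogeneous Besov space, for `s < d / p`. The space is the completion of the
Schwartz functions under the Besov norm; in this range of `s` a sequence of Schwartz functions that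
is Cauchy in the norm converges in `𝓢'`, the limit determines the element of the completion, and
the completion is the space of the limits. -/
def MemBesov {d : ℕ} (φ : Eucl d → ℂ) (s : ℝ) (p r : ℝ≥0∞) [Fact (1 ≤ p)]
    (u : 𝓢'(Eucl d, ℂ)) : Prop :=
  besovNorm φ s p r u < ⊤ ∧
  ∃ f : ℕ → 𝓢(Eucl d, ℂ),
    Tendsto (fun n => (f n : 𝓢'(Eucl d, ℂ))) atTop (𝓝 u) ∧
    Tendsto (fun n => besovNorm φ s p r (u - (f n : 𝓢'(Eucl d, ℂ)))) atTop (𝓝 0)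

/-- The tempered distribution `u` is (integration against) the locally integrable function `f`. -/
def IsRepresentedBy {d : ℕ} (u : 𝓢'(Eucl d, ℂ)) (f : Eucl d → ℂ) : Prop :=
  LocallyIntegrable f volume ∧
  ∀ ψ : 𝓢(Eucl d, ℂ), Integrable (fun x => ψ x * f x) volume ∧ u ψ = ∫ x, ψ x * f x

/-- `G` is the weak gradient (as a differential) of `f` on `ℝ^d`: both are locally integrable, and
`∫ f ∂_v θ = - ∫ θ G(·)v` for all test functions `θ` and all directions `v`. -/
def HasWeakGradient {d : ℕ} (f : Eucl d → ℂ) (G : Eucl d → Eucl d →L[ℝ] ℂ) : Prop :=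
  LocallyIntegrable f volume ∧ LocallyIntegrable G volume ∧
  ∀ θ : Eucl d → ℝ, ContDiff ℝ ∞ θ → HasCompactSupport θ → ∀ v : Eucl d,
    ∫ x, (fderiv ℝ θ x v) • f x = - ∫ x, θ x • G x v

/-- `h = ∂_r f`, that is `h(x) = (x / |x|) · ∇f(x)` for almost every `x`. -/
def IsRadialDeriv {d : ℕ} (f h : Eucl d → ℂ) : Prop :=
  ∃ G : Eucl d → Eucl d →L[ℝ] ℂ, HasWeakGradient f G ∧ ∀ᵐ x, h x = G x (‖x‖⁻¹ • x)

end

/-! Everything is proved for one Littlewood-Paley block at a time, with a bound of the form constant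
times `2^(js) ‖P_j u‖_p`. Since the summation index of the Besov norm is `1`, adding the blocks
finishes the proof.

Weighted `L¹` norms. The symbol of `P_j` is unchanged by multiplication with a wider cutoff, so `P_j
u` is the convolution of its own `L¹` representative with `2^(jd) κ(2^j x)`, where `κ` is a Schwartz
function. For `a < d` the integral of `|x|^(-a) |κ(x - y)|` over `x` is bounded uniformly in `y`. By
Tonelli and scaling, `m` derivatives with weight `|x|^(-a)` cost `2^(j(m+a))`, and `a = s - m` gives
`2^(js)` for every `m` (`exists_isBlock`). Radial symmetry plays no role in this step.

Suprema. For a radial function with profile `q` vanishing at infinity, `r^(d-2) |q(r)|` is at most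
the integral of `s^(d-2) |q'(s)|` over `s > r`. In polar coordinates this is an integral of
`|x|^(-1)` times a gradient, which is one of the weighted `L¹` norms. The `L²` estimate applies the
same argument to `|q|²`, followed by Cauchy-Schwarz (`IsRadialFun.sq_le_eLpNorm_mul`) and
Bernstein's inequality.

Two points remain. Blocks do not see polynomials, so convergence of the block series to `u` rests on
approximation by Schwartz functions (`tendsto_sum_lpProj_of_memBesov`). The field `x / |x|` is
singular at the origin, so the weak gradient of a radial derivative is found by regularisation
(`hasWeakGradient_radialDeriv`); weak gradients then pass to series by local domination
(`HasWeakGradient.tsum`). -/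

set_option maxSynthPendingDepth 3

noncomputable section

/-! ### Power weights and weighted `L¹` bounds for convolutions. -/

/-- The power weight `|x|^{-a}`. -/
def powWeight {d : ℕ} (a : ℕ) (x : Eucl d) : ℝ≥0∞ := ‖(1 / ‖x‖ ^ a : ℝ)‖ₑ

lemma measurable_powWeight {d : ℕ} (a : ℕ) : Measurable (powWeight (d := d) a) := by
  unfold powWeight; fun_prop

lemma powWeight_smul {d : ℕ} (a : ℕ) {c : ℝ} (hc : 0 < c) (x : Eucl d) :
    powWeight a (c • x) = ENNReal.ofReal (c⁻¹ ^ a) * powWeight a x := by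
  unfold powWeight
  rw [norm_smul, mul_pow, one_div, mul_inv, enorm_mul, Real.norm_of_nonneg hc.le,
    Real.enorm_of_nonneg (by positivity : 0 ≤ (c ^ a)⁻¹), inv_pow, one_div]

lemma powWeight_le_one {d : ℕ} (a : ℕ) {x : Eucl d} (hx : 1 ≤ ‖x‖) : powWeight a x ≤ 1 := by
  unfold powWeight
  rw [Real.enorm_of_nonneg (by positivity), ← ENNReal.ofReal_one]
  apply ENNReal.ofReal_le_ofReal
  rw [div_le_one (by positivity)]
  exact one_le_pow₀ hx

lemma powWeight_ne_top {d : ℕ} (a : ℕ) (x : Eucl d) : powWeight a x ≠ ⊤ := enorm_ne_top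

lemma powWeight_pos {d : ℕ} (a : ℕ) {x : Eucl d} (hx : x ≠ 0) : 0 < powWeight a x := by
  unfold powWeight
  have : 0 < ‖x‖ := norm_pos_iff.2 hx
  rw [Real.enorm_of_nonneg (by positivity)]
  exact ENNReal.ofReal_pos.2 (by positivity)

lemma lintegral_powWeight_ball_lt_top {d : ℕ} {a : ℕ} (ha : a < d) :
    ∫⁻ x in Metric.ball (0 : Eucl d) 1, powWeight a x < ⊤ := by
  have : IntegrableOn (fun x : Eucl d => (1 / ‖x‖ ^ a : ℝ)) (Metric.ball (0 : Eucl d) 1) volume := by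
    refine integrableOn_ball_of_norm_le_rpow (C := 1) (α := a) ?_ ?_ ?_ ?_
    · simp only [finrank_euclideanSpace_fin]; omega
    · simp only [finrank_euclideanSpace_fin]; exact_mod_cast ha
    · refine Eventually.of_forall fun x => ?_
      rw [Real.norm_of_nonneg (by positivity), Real.rpow_neg (norm_nonneg _), Real.rpow_natCast]
      simp
    · have : Measurable (fun x : Eucl d => (1 / ‖x‖ ^ a : ℝ)) := by fun_prop
      exact this.aestronglyMeasurable
  exact this.2

lemma lintegral_comp_pos_smul {d : ℕ} {c : ℝ} (hc : 0 < c) (f : Eucl d → ℝ≥0∞) :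
    ∫⁻ x, f (c • x) = ENNReal.ofReal (c⁻¹ ^ d) * ∫⁻ x, f x := by
  have e : MeasurableEmbedding (fun x : Eucl d => c • x) :=
    (Homeomorph.smulOfNeZero c hc.ne').measurableEmbedding
  rw [← e.lintegral_map f, Measure.map_addHaar_smul _ hc.ne', lintegral_smul_measure, smul_eq_mul]
  congr 2
  rw [finrank_euclideanSpace_fin, inv_pow, abs_of_pos (by positivity)]

/-- On the unit ball the kernel is bounded and the weight is integrable because `a < d`. Off the
ball the weight is at most `1` and the kernel is integrable. Neither bound depends on the
translation `y`. -/
lemma exists_lintegral_powWeight_le {d : ℕ} {F : Type*} [NormedAddCommGroup F] {k : Eucl d → F}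
    (hk : Integrable k) {M : ℝ} (hM : ∀ x, ‖k x‖ ≤ M) {a : ℕ} (ha : a < d) :
    ∃ C : ℝ≥0, ∀ y, ∫⁻ x, powWeight a x * ‖k (x - y)‖ₑ ≤ C := by
  set A := ∫⁻ x in Metric.ball (0 : Eucl d) 1, powWeight a x
  set B := ∫⁻ x, ‖k x‖ₑ
  have hA : A ≠ ⊤ := (lintegral_powWeight_ball_lt_top ha).ne
  have hB : B ≠ ⊤ := hk.2.ne
  refine ⟨(A * ENNReal.ofReal M + B).toNNReal, fun y => ?_⟩
  rw [ENNReal.coe_toNNReal (by finiteness)]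
  rw [← lintegral_add_compl _ (measurableSet_ball (x := (0 : Eucl d)) (ε := 1))]
  gcongr
  · rw [← lintegral_mul_const _ (measurable_powWeight a)]
    gcongr with x
    rw [← ofReal_norm]
    exact ENNReal.ofReal_le_ofReal (hM _)
  · calc ∫⁻ x in (Metric.ball (0 : Eucl d) 1)ᶜ, powWeight a x * ‖k (x - y)‖ₑ
        ≤ ∫⁻ x in (Metric.ball (0 : Eucl d) 1)ᶜ, ‖k (x - y)‖ₑ := by
          apply setLIntegral_mono' measurableSet_ball.compl
          intro x hx
          have : 1 ≤ ‖x‖ := by simpa using hx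
          calc _ ≤ 1 * ‖k (x - y)‖ₑ := by gcongr; exact powWeight_le_one a this
            _ = _ := one_mul _
      _ ≤ ∫⁻ x, ‖k (x - y)‖ₑ := setLIntegral_le_lintegral _ _
      _ = B := lintegral_sub_right_eq_self (fun x => ‖k x‖ₑ) y

/-- The kernel `k` rescaled to frequency `l`, with the amplitude of its `m`-th derivative. -/
def dilatedKernel {d : ℕ} {F : Type*} [NormedAddCommGroup F] [NormedSpace ℝ F]
    (m : ℕ) (l : ℝ) (k : Eucl d → F) (x : Eucl d) : F := l ^ (d + m) • k (l • x)

/-- The convolution of a scalar function `g` with a kernel `k`. -/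
def convKernel {d : ℕ} {F : Type*} [NormedAddCommGroup F] [NormedSpace ℝ F] [NormedSpace ℂ F]
    (k : Eucl d → F) (g : Eucl d → ℂ) (x : Eucl d) : F := ∫ y, g y • k (x - y)

section

variable {d : ℕ} {F : Type*} [NormedAddCommGroup F]

lemma integrable_convKernel_integrand [NormedSpace ℂ F] {k : Eucl d → F} (hkc : Continuous k) {M : ℝ}
    (hM : ∀ x, ‖k x‖ ≤ M) {g : Eucl d → ℂ} (hg : Integrable g) (x : Eucl d) :
    Integrable (fun y => g y • k (x - y)) := by
  refine (hg.norm.mul_const M).mono' (hg.1.smul (by fun_prop)) ?_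
  filter_upwards with y
  rw [norm_smul]
  gcongr
  exact hM _

variable [NormedSpace ℝ F]

lemma hasFDerivAt_dilatedKernel {m : ℕ} {l : ℝ} {k : Eucl d → F} {k' : Eucl d → Eucl d →L[ℝ] F}
    (hk : ∀ x, HasFDerivAt k (k' x) x) (x : Eucl d) :
    HasFDerivAt (dilatedKernel m l k) (dilatedKernel (m + 1) l k' x) x := by
  have h1 : HasFDerivAt (fun x : Eucl d => l • x) (l • ContinuousLinearMap.id ℝ (Eucl d)) x :=
    (hasFDerivAt_id x).const_smul l
  have h2 := ((hk (l • x)).comp x h1).const_smul (l ^ (d + m))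
  refine h2.congr_fderiv ?_
  ext v
  simp [dilatedKernel, smul_smul, ← add_assoc, pow_succ]

/-- Change of variables `z = l x`: the amplitude gives `l^(d+m)`, the weight `l^a`, and the Jacobian
`l^(-d)`. -/
lemma lintegral_powWeight_dilatedKernel_le {k : Eucl d → F} {a : ℕ} {C : ℝ≥0}
    (hC : ∀ y, ∫⁻ x, powWeight a x * ‖k (x - y)‖ₑ ≤ C) (m : ℕ) {l : ℝ} (hl : 0 < l) (y : Eucl d) :
    ∫⁻ x, powWeight a x * ‖dilatedKernel m l k (x - y)‖ₑ ≤ ENNReal.ofReal (l ^ (m + a)) * C := by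
  have h1 : ∀ x, powWeight a x * ‖dilatedKernel m l k (x - y)‖ₑ =
      ENNReal.ofReal (l ^ (d + m + a)) *
        (fun z => powWeight a z * ‖k (z - l • y)‖ₑ) (l • x) := by
    intro x
    simp only [dilatedKernel, powWeight_smul a hl, enorm_smul]
    rw [Real.enorm_of_nonneg (by positivity), pow_add l (d + m) a,
      ENNReal.ofReal_mul (by positivity), smul_sub]
    have : ENNReal.ofReal (l ^ a) * ENNReal.ofReal (l⁻¹ ^ a) = 1 := by
      rw [← ENNReal.ofReal_mul (by positivity), ← mul_pow, mul_inv_cancel₀ hl.ne']; simp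
    calc _ = ENNReal.ofReal (l ^ (d + m)) * powWeight a x * ‖k (l • x - l • y)‖ₑ
          * 1 := by ring
      _ = _ := by rw [← this]; ring
  simp_rw [h1]
  rw [lintegral_const_mul' _ _ ENNReal.ofReal_ne_top, lintegral_comp_pos_smul hl
    (fun z => powWeight a z * ‖k (z - l • y)‖ₑ), ← mul_assoc,
    ← ENNReal.ofReal_mul (by positivity)]
  have : l ^ (d + m + a) * l⁻¹ ^ d = l ^ (m + a) := by
    rw [add_assoc, pow_add l d, inv_pow]; field_simp
  rw [this]
  gcongr
  exact hC _

variable [NormedSpace ℂ F]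

lemma continuous_convKernel {k : Eucl d → F} (hkc : Continuous k) {M : ℝ}
    (hM : ∀ x, ‖k x‖ ≤ M) {g : Eucl d → ℂ} (hg : Integrable g) : Continuous (convKernel k g) := by
  refine continuous_of_dominated (bound := fun y => ‖g y‖ * M)
    (fun x => (integrable_convKernel_integrand hkc hM hg x).1) (fun x => ?_)
    (hg.norm.mul_const M) ?_
  · filter_upwards with y
    rw [norm_smul]
    gcongr
    exact hM _
  · filter_upwards with y
    fun_prop

lemma hasFDerivAt_convKernel [SMulCommClass ℝ ℂ F] {k : Eucl d → F}
    {k' : Eucl d → Eucl d →L[ℝ] F}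
    (hk : ∀ x, HasFDerivAt k (k' x) x) (hk'c : Continuous k') {M M' : ℝ}
    (hM : ∀ x, ‖k x‖ ≤ M) (hM' : ∀ x, ‖k' x‖ ≤ M') {g : Eucl d → ℂ} (hg : Integrable g)
    (x : Eucl d) : HasFDerivAt (convKernel k g) (convKernel k' g x) x := by
  have hkc : Continuous k := continuous_iff_continuousAt.2 fun x => (hk x).continuousAt
  refine hasFDerivAt_integral_of_dominated_of_fderiv_le (s := Set.univ)
    (bound := fun y => ‖g y‖ * M') (F' := fun x y => g y • k' (x - y)) Filter.univ_mem
    (Eventually.of_forall fun x => (integrable_convKernel_integrand hkc hM hg x).1)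
    (integrable_convKernel_integrand hkc hM hg x)
    (integrable_convKernel_integrand hk'c hM' hg x).1 ?_ (hg.norm.mul_const M') ?_
  · filter_upwards with y x _
    rw [norm_smul]
    gcongr
    exact hM' _
  · filter_upwards with y x _
    have := ((hk (x - y)).comp x ((hasFDerivAt_id x).sub_const y)).const_smul (g y)
    refine this.congr_fderiv ?_
    ext v
    simp

lemma tendsto_convKernel_cocompact {k : Eucl d → F} (hkc : Continuous k) {M : ℝ}
    (hM : ∀ x, ‖k x‖ ≤ M) (hk : Tendsto k (cocompact _) (𝓝 0)) {g : Eucl d → ℂ}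
    (hg : Integrable g) : Tendsto (convKernel k g) (cocompact _) (𝓝 0) := by
  -- Dominated convergence along a filter needs countable generation; `cocompact` is the pullback of
  -- `atTop` under the norm.
  have hcg : (cocompact (Eucl d)).IsCountablyGenerated := by
    rw [← Metric.cobounded_eq_cocompact, ← comap_norm_atTop]; infer_instance
  have := tendsto_integral_filter_of_dominated_convergence (μ := (volume : Measure (Eucl d)))
    (F := fun x y => g y • k (x - y)) (f := fun _ => (0 : F)) (l := cocompact (Eucl d))
    (fun y => ‖g y‖ * M)
    (Eventually.of_forall fun x => (integrable_convKernel_integrand hkc hM hg x).1)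
    ?_ (hg.norm.mul_const M) ?_
  · rw [integral_zero] at this
    exact this
  · refine Eventually.of_forall fun x => ?_
    filter_upwards with y
    rw [norm_smul]
    gcongr
    exact hM _
  · filter_upwards with y
    have h1 : Tendsto (fun x => x - y) (cocompact (Eucl d)) (cocompact (Eucl d)) := by
      simpa [sub_eq_add_neg] using (Homeomorph.addRight (-y)).isClosedEmbedding.tendsto_cocompact
    simpa using (hk.comp h1).const_smul (g y)

/-- Tonelli: the uniformity of `D` in `y` lets the inner integral be pulled out of the integral
against `g`. -/
lemma lintegral_powWeight_convKernel_le {k : Eucl d → F} (hkc : Continuous k) {a : ℕ}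
    {D : ℝ≥0∞} (hD : ∀ y, ∫⁻ x, powWeight a x * ‖k (x - y)‖ₑ ≤ D)
    {g : Eucl d → ℂ} (hg : Integrable g) :
    ∫⁻ x, powWeight a x * ‖convKernel k g x‖ₑ ≤ D * ∫⁻ y, ‖g y‖ₑ := by
  have hm : AEMeasurable (Function.uncurry fun x y => powWeight a x * (‖g y‖ₑ * ‖k (x - y)‖ₑ))
      ((volume : Measure (Eucl d)).prod volume) := by
    refine ((measurable_powWeight a).comp measurable_fst).aemeasurable.mul
      (AEMeasurable.mul (f := fun p : Eucl d × Eucl d => ‖g p.2‖ₑ)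
        (g := fun p : Eucl d × Eucl d => ‖k (p.1 - p.2)‖ₑ) ?_ ?_)
    · exact hg.1.enorm.comp_snd
    · have : Continuous fun p : Eucl d × Eucl d => ‖k (p.1 - p.2)‖ₑ := by fun_prop
      exact this.measurable.aemeasurable
  calc ∫⁻ x, powWeight a x * ‖convKernel k g x‖ₑ
      ≤ ∫⁻ x, powWeight a x * ∫⁻ y, ‖g y‖ₑ * ‖k (x - y)‖ₑ := by
        gcongr with x
        refine (enorm_integral_le_lintegral_enorm _).trans_eq ?_
        simp_rw [enorm_smul]
    _ = ∫⁻ x, ∫⁻ y, powWeight a x * (‖g y‖ₑ * ‖k (x - y)‖ₑ) := by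
        congr with x
        rw [lintegral_const_mul' _ _ (powWeight_ne_top a x)]
    _ = ∫⁻ y, ∫⁻ x, powWeight a x * (‖g y‖ₑ * ‖k (x - y)‖ₑ) := lintegral_lintegral_swap hm
    _ = ∫⁻ y, ‖g y‖ₑ * ∫⁻ x, powWeight a x * ‖k (x - y)‖ₑ := by
        congr with y
        rw [← lintegral_const_mul' _ _ enorm_ne_top]
        congr with x
        ring
    _ ≤ ∫⁻ y, ‖g y‖ₑ * D := by gcongr with y; exact hD y
    _ = D * ∫⁻ y, ‖g y‖ₑ := by rw [lintegral_mul_const'' _ hg.1.enorm, mul_comm]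

end

/-! ### Weak gradients: smooth functions, dominated limits, series. -/

section

variable {d : ℕ}

lemma hasWeakGradient_of_hasFDerivAt {f : Eucl d → ℂ} {G : Eucl d → Eucl d →L[ℝ] ℂ}
    (hf : ∀ x, HasFDerivAt f (G x) x) (hG : Continuous G) : HasWeakGradient f G := by
  have hfd : Differentiable ℝ f := fun x => (hf x).differentiableAt
  have hfc : Continuous f := hfd.continuous
  refine ⟨hfc.locallyIntegrable, hG.locallyIntegrable, fun θ hθ hc v => ?_⟩
  have hG' : ∀ x, fderiv ℝ f x = G x := fun x => (hf x).fderiv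
  have hθc : Continuous θ := hθ.continuous
  have hθ' : Continuous (fun x => fderiv ℝ θ x v) :=
    (hθ.continuous_fderiv (by simp)).clm_apply continuous_const
  have hθd : Differentiable ℝ θ := hθ.differentiable (by simp)
  have hs : HasCompactSupport (fun x => fderiv ℝ θ x v) := hc.fderiv_apply (𝕜 := ℝ) v
  have := integral_smul_fderiv_eq_neg_fderiv_smul_of_integrable
    (μ := (volume : Measure (Eucl d))) (f := θ) (g := f) (v := v)
    ((hθ'.smul hfc).integrable_of_hasCompactSupport hs.smul_right) ?_
    ((hθc.smul hfc).integrable_of_hasCompactSupport hc.smul_right)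
    (fun x _ => hθd x) (fun x _ => hfd x)
  · simp_rw [hG'] at this
    rw [this, neg_neg]
  · simp_rw [hG']
    exact (hθc.smul (hG.clm_apply continuous_const)).integrable_of_hasCompactSupport hc.smul_right

/-- Dominated convergence in both sides of the defining identity: a locally integrable envelope
times a compactly supported test function is integrable. -/
lemma HasWeakGradient.of_tendsto {f : Eucl d → ℂ} {G : Eucl d → Eucl d →L[ℝ] ℂ}
    {fn : ℕ → Eucl d → ℂ} {Gn : ℕ → Eucl d → Eucl d →L[ℝ] ℂ}
    (h : ∀ n, HasWeakGradient (fn n) (Gn n))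
    {B B' : Eucl d → ℝ} (hB : LocallyIntegrable B) (hB' : LocallyIntegrable B')
    (hfB : ∀ n, ∀ᵐ x, ‖fn n x‖ ≤ B x) (hGB : ∀ n, ∀ᵐ x, ‖Gn n x‖ ≤ B' x)
    (hf : ∀ᵐ x, Tendsto (fun n => fn n x) atTop (𝓝 (f x)))
    (hG : ∀ᵐ x, Tendsto (fun n => Gn n x) atTop (𝓝 (G x))) : HasWeakGradient f G := by
  have hfm : AEStronglyMeasurable f :=
    aestronglyMeasurable_of_tendsto_ae atTop (fun n => (h n).1.aestronglyMeasurable) hf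
  have hGm : AEStronglyMeasurable G :=
    aestronglyMeasurable_of_tendsto_ae atTop (fun n => (h n).2.1.aestronglyMeasurable) hG
  refine ⟨hB.mono hfm ?_, hB'.mono hGm ?_, fun θ hθ hc v => ?_⟩
  · filter_upwards [hf, ae_all_iff.2 hfB] with x hx hxB
    exact (le_of_tendsto hx.norm (Eventually.of_forall hxB)).trans (le_abs_self _)
  · filter_upwards [hG, ae_all_iff.2 hGB] with x hx hxB
    exact (le_of_tendsto hx.norm (Eventually.of_forall hxB)).trans (le_abs_self _)
  have hθc : Continuous θ := hθ.continuous
  have hθ' : Continuous (fun x => fderiv ℝ θ x v) :=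
    (hθ.continuous_fderiv (by simp)).clm_apply continuous_const
  have hs : HasCompactSupport (fun x => fderiv ℝ θ x v) := hc.fderiv_apply (𝕜 := ℝ) v
  have h1 : Tendsto (fun n => ∫ x, (fderiv ℝ θ x v) • fn n x) atTop
      (𝓝 (∫ x, (fderiv ℝ θ x v) • f x)) := by
    refine tendsto_integral_of_dominated_convergence (fun x => ‖fderiv ℝ θ x v‖ • B x)
      (fun n => hθ'.aestronglyMeasurable.smul (h n).1.aestronglyMeasurable)
      (hB.integrable_smul_left_of_hasCompactSupport hθ'.norm hs.norm) (fun n => ?_) ?_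
    · filter_upwards [hfB n] with x hx
      rw [norm_smul, smul_eq_mul]
      gcongr
    · filter_upwards [hf] with x hx
      exact hx.const_smul _
  have h2 : Tendsto (fun n => -∫ x, θ x • Gn n x v) atTop (𝓝 (-∫ x, θ x • G x v)) := by
    refine (tendsto_integral_of_dominated_convergence (fun x => ‖θ x‖ • (‖v‖ * B' x))
      (fun n => hθc.aestronglyMeasurable.smul ?_) ?_ (fun n => ?_) ?_).neg
    · exact (ContinuousLinearMap.apply ℝ ℂ v).continuous.comp_aestronglyMeasurable
        (h n).2.1.aestronglyMeasurable
    · have := (hB'.smul ‖v‖).integrable_smul_left_of_hasCompactSupport hθc.norm hc.norm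
      simpa using this
    · filter_upwards [hGB n] with x hx
      change ‖θ x • Gn n x v‖ ≤ _
      rw [norm_smul, smul_eq_mul]
      gcongr
      rw [mul_comm]
      exact (ContinuousLinearMap.le_opNorm _ _).trans (by gcongr)
    · filter_upwards [hG] with x hx
      exact ((ContinuousLinearMap.apply ℝ ℂ v).continuous.tendsto _ |>.comp hx).const_smul _
  refine tendsto_nhds_unique h1 (h2.congr fun n => ?_)
  exact ((h n).2.2 θ hθ hc v).symm

/-- On the ball of radius `R` the weight is at least `R^(-a)`, so it can be inserted at the cost of
a constant. -/
lemma locallyIntegrable_of_lintegral_powWeight {F : Type*} [NormedAddCommGroup F] (hd : 0 < d)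
    {a : ℕ} {f : Eucl d → F} (hm : AEStronglyMeasurable f)
    (hf : ∫⁻ x, powWeight a x * ‖f x‖ₑ ≠ ⊤) : LocallyIntegrable f := by
  have : Nonempty (Fin d) := ⟨⟨0, hd⟩⟩
  rw [locallyIntegrable_iff]
  intro K hK
  obtain ⟨R, hR0, hR⟩ := hK.isBounded.exists_pos_norm_lt
  refine ⟨hm.restrict, ?_⟩
  rw [hasFiniteIntegral_iff_enorm]
  calc ∫⁻ x in K, ‖f x‖ₑ
      ≤ ∫⁻ x in K, ENNReal.ofReal (R ^ a) * (powWeight a x * ‖f x‖ₑ) := by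
        apply lintegral_mono_ae
        have h0 : ∀ᵐ x : Eucl d, x ≠ 0 := by simp [ae_iff]
        filter_upwards [ae_restrict_mem hK.measurableSet, ae_restrict_of_ae h0] with x hx hx0
        rw [← mul_assoc]
        refine le_mul_of_one_le_left zero_le ?_
        have : 0 < ‖x‖ := norm_pos_iff.2 hx0
        rw [powWeight, Real.enorm_of_nonneg (by positivity), ← ENNReal.ofReal_mul (by positivity),
          ← ENNReal.ofReal_one]
        apply ENNReal.ofReal_le_ofReal
        rw [mul_one_div, one_le_div (by positivity)]
        gcongr
        exact (hR x hx).le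
    _ = ENNReal.ofReal (R ^ a) * ∫⁻ x in K, powWeight a x * ‖f x‖ₑ :=
        lintegral_const_mul' _ _ ENNReal.ofReal_ne_top
    _ ≤ ENNReal.ofReal (R ^ a) * ∫⁻ x, powWeight a x * ‖f x‖ₑ := by
        gcongr; exact Measure.restrict_le_self
    _ < ⊤ := ENNReal.mul_lt_top ENNReal.ofReal_lt_top hf.lt_top

section sums

variable {ι : Type*} [Countable ι] {F : Type*} [NormedAddCommGroup F]
  {a : ℕ} {f : ι → Eucl d → F}

lemma lintegral_powWeight_tsum_enorm (hm : ∀ j, AEStronglyMeasurable (f j)) :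
    ∫⁻ x, powWeight a x * ∑' j, ‖f j x‖ₑ = ∑' j, ∫⁻ x, powWeight a x * ‖f j x‖ₑ := by
  simp_rw [← ENNReal.tsum_mul_left]
  exact lintegral_tsum fun j => (measurable_powWeight a).aemeasurable.mul (hm j).enorm

lemma ae_summable_norm_of_powWeight (hd : 0 < d) (hm : ∀ j, AEStronglyMeasurable (f j))
    (hf : ∑' j, ∫⁻ x, powWeight a x * ‖f j x‖ₑ ≠ ⊤) : ∀ᵐ x, Summable fun j => ‖f j x‖ := by
  have : Nonempty (Fin d) := ⟨⟨0, hd⟩⟩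
  rw [← lintegral_powWeight_tsum_enorm hm] at hf
  have h0 : ∀ᵐ x : Eucl d, x ≠ 0 := by simp [ae_iff]
  have hM : AEMeasurable fun x => powWeight a x * ∑' j, ‖f j x‖ₑ :=
    (measurable_powWeight a).aemeasurable.mul (AEMeasurable.tsum fun j => (hm j).enorm)
  filter_upwards [ae_lt_top' hM hf, h0] with x hx hx0
  have : ∑' j, ‖f j x‖ₑ ≠ ⊤ := by
    intro h
    rw [h, ENNReal.mul_top (powWeight_pos a hx0).ne'] at hx
    exact lt_irrefl _ hx
  simp_rw [← ofReal_norm] at this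
  exact (ENNReal.summable_toReal this).congr fun j => by simp

lemma lintegral_powWeight_tsum_le [CompleteSpace F] (hm : ∀ j, AEStronglyMeasurable (f j)) :
    ∫⁻ x, powWeight a x * ‖∑' j, f j x‖ₑ ≤ ∑' j, ∫⁻ x, powWeight a x * ‖f j x‖ₑ := by
  rw [← lintegral_powWeight_tsum_enorm hm]
  gcongr with x
  exact enorm_tsum_le_tsum_enorm

lemma locallyIntegrable_tsum_norm_of_powWeight (hd : 0 < d) (hm : ∀ j, AEStronglyMeasurable (f j))
    (hf : ∑' j, ∫⁻ x, powWeight a x * ‖f j x‖ₑ ≠ ⊤) :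
    LocallyIntegrable fun x => ∑' j, ‖f j x‖ := by
  have hm' : ∀ j, AEStronglyMeasurable fun x => ‖f j x‖ := fun j => (hm j).norm
  refine locallyIntegrable_of_lintegral_powWeight (a := a) hd ?_ (ne_top_of_le_ne_top hf ?_)
  · have : AEMeasurable fun x => (∑' j, ‖f j x‖ₑ).toReal :=
      (AEMeasurable.tsum fun j => (hm j).enorm).ennreal_toReal
    refine this.aestronglyMeasurable.congr ?_
    filter_upwards [ae_summable_norm_of_powWeight hd hm hf] with x hx
    simp_rw [← ofReal_norm]
    rw [← ENNReal.ofReal_tsum_of_nonneg (fun _ => norm_nonneg _) hx,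
      ENNReal.toReal_ofReal (tsum_nonneg fun _ => norm_nonneg _)]
  · simpa using lintegral_powWeight_tsum_le (a := a) hm'

end sums

lemma locallyIntegrable_sum_of_normed {ι F : Type*} [NormedAddCommGroup F] (s : Finset ι)
    {f : ι → Eucl d → F} (hf : ∀ i ∈ s, LocallyIntegrable (f i)) :
    LocallyIntegrable (fun x => ∑ i ∈ s, f i x) :=
  locallyIntegrable_finsetSum s hf

lemma HasWeakGradient.sum {ι : Type*} {f : ι → Eucl d → ℂ} {G : ι → Eucl d → Eucl d →L[ℝ] ℂ}
    (h : ∀ j, HasWeakGradient (f j) (G j)) (s : Finset ι) :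
    HasWeakGradient (fun x => ∑ j ∈ s, f j x) (fun x => ∑ j ∈ s, G j x) := by
  refine ⟨locallyIntegrable_finsetSum s fun j _ => (h j).1,
    locallyIntegrable_sum_of_normed s fun j _ => (h j).2.1, fun θ hθ hc v => ?_⟩
  have hθc : Continuous θ := hθ.continuous
  have hθ' : Continuous (fun x => fderiv ℝ θ x v) :=
    (hθ.continuous_fderiv (by simp)).clm_apply continuous_const
  have hs : HasCompactSupport (fun x => fderiv ℝ θ x v) := hc.fderiv_apply (𝕜 := ℝ) v
  simp_rw [sum_apply, Finset.smul_sum]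
  rw [integral_finsetSum _ fun j _ =>
      (h j).1.integrable_smul_left_of_hasCompactSupport hθ' hs,
    integral_finsetSum, ← Finset.sum_neg_distrib]
  · exact Finset.sum_congr rfl fun j _ => (h j).2.2 θ hθ hc v
  · intro j _
    exact (ContinuousLinearMap.apply ℝ ℂ v).integrable_comp
      ((h j).2.1.integrable_smul_left_of_hasCompactSupport hθc hc)

/-- The weighted sums are used only qualitatively: they give absolute convergence almost everywhere,
and the sums of norms serve as locally integrable envelopes for the symmetric partial sums. Hence
the two exponents may differ. -/
lemma HasWeakGradient.tsum {f : ℤ → Eucl d → ℂ} {G : ℤ → Eucl d → Eucl d →L[ℝ] ℂ} (hd : 0 < d)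
    {a b : ℕ} (h : ∀ j, HasWeakGradient (f j) (G j))
    (hf : ∑' j, ∫⁻ x, powWeight a x * ‖f j x‖ₑ ≠ ⊤)
    (hG : ∑' j, ∫⁻ x, powWeight b x * ‖G j x‖ₑ ≠ ⊤) :
    HasWeakGradient (fun x => ∑' j, f j x) (fun x => ∑' j, G j x) := by
  have hfm := fun j => (h j).1.aestronglyMeasurable
  have hGm := fun j => (h j).2.1.aestronglyMeasurable
  have hsf := ae_summable_norm_of_powWeight hd hfm hf
  have hsG := ae_summable_norm_of_powWeight hd hGm hG
  refine HasWeakGradient.of_tendsto (fun n : ℕ => HasWeakGradient.sum h (Finset.Icc (-n : ℤ) n))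
    (locallyIntegrable_tsum_norm_of_powWeight hd hfm hf)
    (locallyIntegrable_tsum_norm_of_powWeight hd hGm hG) (fun n => ?_) (fun n => ?_) ?_ ?_
  · filter_upwards [hsf] with x hx
    exact (norm_sum_le _ _).trans (hx.sum_le_tsum _ fun _ _ => norm_nonneg _)
  · filter_upwards [hsG] with x hx
    exact (norm_sum_le _ _).trans (hx.sum_le_tsum _ fun _ _ => norm_nonneg _)
  · filter_upwards [hsf] with x hx
    exact hx.of_norm.hasSum.comp Finset.tendsto_Icc_neg
  · filter_upwards [hsG] with x hx
    exact hx.of_norm.hasSum.comp Finset.tendsto_Icc_neg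

end

/-! ### The weak gradient of a radial derivative, by regularising `x / |x|`. -/

section

variable {d : ℕ}

/-- The regularisation `(|x|² + ε²)^{-1/2}` of `1 / |x|`. -/
def invRegNorm (ε : ℝ) (x : Eucl d) : ℝ := (√(‖x‖ ^ 2 + ε ^ 2))⁻¹

/-- The regularisation `x / (|x|² + ε²)^{1/2}` of the unit vector field `x / |x|`. -/
def unitVec (ε : ℝ) (x : Eucl d) : Eucl d := invRegNorm ε x • x

/-- The differential of `unitVec ε`. -/
def unitVecDeriv (ε : ℝ) (x : Eucl d) : Eucl d →L[ℝ] Eucl d :=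
  invRegNorm ε x • ContinuousLinearMap.id ℝ (Eucl d)
    - invRegNorm ε x ^ 3 • (innerSL ℝ x).smulRight x

lemma invRegNorm_nonneg (ε : ℝ) (x : Eucl d) : 0 ≤ invRegNorm ε x := by
  unfold invRegNorm; positivity

lemma invRegNorm_mul_norm_le (ε : ℝ) (x : Eucl d) : invRegNorm ε x * ‖x‖ ≤ 1 := by
  refine inv_mul_le_one_of_le₀ (Real.le_sqrt_of_sq_le ?_) (Real.sqrt_nonneg _)
  nlinarith [sq_nonneg ε]

lemma invRegNorm_zero (x : Eucl d) : invRegNorm 0 x = ‖x‖⁻¹ := by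
  simp [invRegNorm]

lemma unitVec_zero (x : Eucl d) : unitVec 0 x = ‖x‖⁻¹ • x := by
  rw [unitVec, invRegNorm_zero]

lemma norm_unitVec_le (ε : ℝ) (x : Eucl d) : ‖unitVec ε x‖ ≤ 1 := by
  rw [unitVec, norm_smul, Real.norm_of_nonneg (invRegNorm_nonneg _ _)]
  exact invRegNorm_mul_norm_le ε x

/-- The bound does not involve `ε`, so it supplies a dominating function as `ε → 0`. -/
lemma norm_unitVecDeriv_le (ε : ℝ) {x : Eucl d} (hx : x ≠ 0) :
    ‖unitVecDeriv ε x‖ ≤ 2 * (1 / ‖x‖) := by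
  have h0 := invRegNorm_nonneg ε x
  have h1 := invRegNorm_mul_norm_le ε x
  have hx' : 0 < ‖x‖ := norm_pos_iff.2 hx
  have h2 : invRegNorm ε x ≤ 1 / ‖x‖ := by rwa [le_div_iff₀ hx']
  refine ContinuousLinearMap.opNorm_le_bound _ (by positivity) fun v => ?_
  have h3 : ‖unitVecDeriv ε x v‖ ≤ invRegNorm ε x * ‖v‖
      + invRegNorm ε x ^ 3 * (‖x‖ * ‖v‖ * ‖x‖) := by
    simp only [unitVecDeriv, sub_apply, smul_apply, ContinuousLinearMap.id_apply,
      ContinuousLinearMap.smulRight_apply, innerSL_apply_apply]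
    refine (norm_sub_le _ _).trans ?_
    rw [norm_smul, norm_smul, norm_smul, Real.norm_of_nonneg h0,
      Real.norm_of_nonneg (by positivity : 0 ≤ invRegNorm ε x ^ 3)]
    gcongr
    exact norm_inner_le_norm _ _
  have h4 : invRegNorm ε x ^ 3 * (‖x‖ * ‖v‖ * ‖x‖) ≤ invRegNorm ε x * ‖v‖ := by
    calc _ = invRegNorm ε x * ‖v‖ * (invRegNorm ε x * ‖x‖) ^ 2 := by ring
      _ ≤ invRegNorm ε x * ‖v‖ * 1 := by
          gcongr
          exact pow_le_one₀ (by positivity) h1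
      _ = _ := mul_one _
  have h5 : invRegNorm ε x * ‖v‖ ≤ 1 / ‖x‖ * ‖v‖ := by gcongr
  linarith

lemma hasFDerivAt_unitVec {ε : ℝ} (hε : ε ≠ 0) (x : Eucl d) :
    HasFDerivAt (unitVec ε) (unitVecDeriv ε x) x := by
  have hpos : 0 < ‖x‖ ^ 2 + ε ^ 2 := by positivity
  have hs : √(‖x‖ ^ 2 + ε ^ 2) ≠ 0 := (Real.sqrt_pos.2 hpos).ne'
  have h1 : HasFDerivAt (fun x : Eucl d => ‖x‖ ^ 2 + ε ^ 2) (2 • innerSL ℝ x) x :=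
    (hasStrictFDerivAt_norm_sq x).hasFDerivAt.add_const _
  have h2 := ((Real.hasDerivAt_sqrt hpos.ne').inv hs).comp_hasFDerivAt x h1
  have h3 := h2.smul (hasFDerivAt_id x)
  refine h3.congr_fderiv ?_
  ext1 v
  simp only [unitVecDeriv, invRegNorm, add_apply, smul_apply,
    ContinuousLinearMap.id_apply, ContinuousLinearMap.smulRight_apply, innerSL_apply_apply,
    Function.comp, id, Pi.inv_apply, sub_eq_add_neg, nsmul_eq_mul, smul_eq_mul]
  congr 2
  simp only [smul_apply, ContinuousLinearMap.smulRight_apply, innerSL_apply_apply,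
    smul_smul, ← neg_smul]
  congr 1
  field_simp
  simp

lemma continuousAt_invRegNorm_zero {x : Eucl d} (hx : x ≠ 0) :
    ContinuousAt (fun ε => invRegNorm ε x) 0 := by
  unfold invRegNorm
  have hx' : 0 < ‖x‖ := norm_pos_iff.2 hx
  refine ContinuousAt.inv₀ (by fun_prop) ?_
  simpa using hx

/-- The gradient of the radial derivative `x ↦ G₁ x (x / |x|)`, where `G₂` is the differential
of `G₁`. -/
def gradRadialDeriv (G₁ : Eucl d → Eucl d →L[ℝ] ℂ) (G₂ : Eucl d → Eucl d →L[ℝ] Eucl d →L[ℝ] ℂ)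
    (ε : ℝ) (x : Eucl d) : Eucl d →L[ℝ] ℂ :=
  (G₁ x).comp (unitVecDeriv ε x) + (G₂ x).flip (unitVec ε x)

lemma norm_gradRadialDeriv_le (G₁ : Eucl d → Eucl d →L[ℝ] ℂ)
    (G₂ : Eucl d → Eucl d →L[ℝ] Eucl d →L[ℝ] ℂ) (ε : ℝ) {x : Eucl d} (hx : x ≠ 0) :
    ‖gradRadialDeriv G₁ G₂ ε x‖ ≤ 2 * (1 / ‖x‖ * ‖G₁ x‖) + ‖G₂ x‖ := by
  refine (norm_add_le _ _).trans (add_le_add ?_ ?_)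
  · calc _ ≤ ‖G₁ x‖ * ‖unitVecDeriv ε x‖ := ContinuousLinearMap.opNorm_comp_le _ _
      _ ≤ ‖G₁ x‖ * (2 * (1 / ‖x‖)) := by gcongr; exact norm_unitVecDeriv_le ε hx
      _ = _ := by ring
  · calc _ ≤ ‖(G₂ x).flip‖ * ‖unitVec ε x‖ := ContinuousLinearMap.le_opNorm _ _
      _ ≤ ‖(G₂ x).flip‖ * 1 := by gcongr; exact norm_unitVec_le ε x
      _ = _ := by simp

/-- With `unitVec ε` in place of `x / |x|` the product is differentiable with continuous derivative.
As `ε = 1 / (n + 1)` tends to zero the functions are dominated by `‖G₁‖` and the gradients by `2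
‖G₁‖ / |x| + ‖G₂‖`; the hypothesis `hG₁` makes the latter locally integrable. -/
lemma hasWeakGradient_radialDeriv (hd : 0 < d) {G₁ : Eucl d → Eucl d →L[ℝ] ℂ}
    {G₂ : Eucl d → Eucl d →L[ℝ] Eucl d →L[ℝ] ℂ} (hG : ∀ x, HasFDerivAt G₁ (G₂ x) x)
    (hc : Continuous G₂) (hG₁ : ∫⁻ x, powWeight 1 x * ‖G₁ x‖ₑ ≠ ⊤) :
    HasWeakGradient (fun x => G₁ x (‖x‖⁻¹ • x)) (gradRadialDeriv G₁ G₂ 0) := by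
  have : Nonempty (Fin d) := ⟨⟨0, hd⟩⟩
  have h0 : ∀ᵐ x : Eucl d, x ≠ 0 := by simp [ae_iff]
  have hG₁c : Continuous G₁ := continuous_iff_continuousAt.2 fun x => (hG x).continuousAt
  have hli : LocallyIntegrable (fun x => 1 / ‖x‖ * ‖G₁ x‖) := by
    have hm : Measurable (fun x : Eucl d => 1 / ‖x‖) := by fun_prop
    refine Integrable.locallyIntegrable ⟨hm.aestronglyMeasurable.mul
      hG₁c.norm.aestronglyMeasurable, ?_⟩
    rw [hasFiniteIntegral_iff_enorm]
    simpa [powWeight, enorm_mul] using hG₁.lt_top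
  have hε : ∀ n : ℕ, (1 / ((n : ℝ) + 1)) ≠ 0 := fun n => by positivity
  refine HasWeakGradient.of_tendsto
    (fn := fun n x => G₁ x (unitVec (1 / ((n : ℝ) + 1)) x))
    (Gn := fun n => gradRadialDeriv G₁ G₂ (1 / ((n : ℝ) + 1))) (fun n => ?_)
    hG₁c.norm.locallyIntegrable
    ((hli.smul (2 : ℝ)).add hc.norm.locallyIntegrable) (fun n => ?_) (fun n => ?_) ?_ ?_
  · have hu : Continuous (unitVec (d := d) (1 / ((n : ℝ) + 1))) :=
      continuous_iff_continuousAt.2 fun x => (hasFDerivAt_unitVec (hε n) x).continuousAt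
    have hi : Continuous (invRegNorm (d := d) (1 / ((n : ℝ) + 1))) := by
      unfold invRegNorm
      refine Continuous.inv₀ (by fun_prop) fun x => (Real.sqrt_pos.2 ?_).ne'
      have := hε n
      positivity
    refine hasWeakGradient_of_hasFDerivAt (fun x => ?_) ?_
    · exact (hG x).clm_apply (hasFDerivAt_unitVec (hε n) x)
    · refine (hG₁c.clm_comp ?_).add (Continuous.clm_apply ?_ hu)
      · unfold unitVecDeriv
        refine (hi.smul continuous_const).sub ((hi.pow 3).smul ?_)
        exact (ContinuousLinearMap.smulRightL ℝ (Eucl d) (Eucl d)).continuous₂.comp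
          (((innerSL ℝ).continuous).prodMk continuous_id)
      · exact (ContinuousLinearMap.flipₗᵢ ℝ (Eucl d) (Eucl d) ℂ).continuous.comp hc
  · refine Eventually.of_forall fun x => ?_
    exact (ContinuousLinearMap.le_opNorm _ _).trans
      (mul_le_of_le_one_right (norm_nonneg _) (norm_unitVec_le _ _))
  · filter_upwards [h0] with x hx
    exact norm_gradRadialDeriv_le G₁ G₂ _ hx
  all_goals
    filter_upwards [h0] with x hx
    have hlim : Tendsto (fun n : ℕ => invRegNorm (1 / ((n : ℝ) + 1)) x) atTop
        (𝓝 (invRegNorm 0 x)) :=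
      (continuousAt_invRegNorm_zero hx).tendsto.comp tendsto_one_div_add_atTop_nhds_zero_nat
  · rw [← unitVec_zero]
    exact ((G₁ x).continuous.tendsto _).comp (hlim.smul_const x)
  · unfold gradRadialDeriv
    refine Tendsto.add ?_ (((G₂ x).flip.continuous.tendsto _).comp (hlim.smul_const x))
    refine ((ContinuousLinearMap.compL ℝ (Eucl d) (Eucl d) ℂ (G₁ x)).continuous.tendsto _).comp ?_
    exact (hlim.smul_const _).sub ((hlim.pow 3).smul_const _)

end

/-! ### Polar coordinates and decay of radial functions. -/

section

variable {d : ℕ}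

lemma lintegral_fun_norm (hd : 0 < d) {f : ℝ → ℝ≥0∞} (hf : Measurable f) :
    ∫⁻ x : Eucl d, f ‖x‖ = (volume : Measure (Eucl d)).toSphere Set.univ *
      ∫⁻ s in Set.Ioi (0 : ℝ), ENNReal.ofReal (s ^ (d - 1)) * f s := by
  have : Nonempty (Fin d) := ⟨⟨0, hd⟩⟩
  set μ : Measure (Eucl d) := volume
  have hfin : Module.finrank ℝ (Eucl d) - 1 = d - 1 := by simp
  calc ∫⁻ x, f ‖x‖ ∂μ = ∫⁻ x : ({(0)}ᶜ : Set (Eucl d)), f (‖x.1‖) ∂(μ.comap (↑)) := by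
        rw [lintegral_subtype_comap (measurableSet_singleton _).compl fun x ↦ f (‖x‖),
          restrict_compl_singleton]
    _ = ∫⁻ p, f p.2 ∂μ.toSphere.prod (.volumeIoiPow (Module.finrank ℝ (Eucl d) - 1)) := by
        have := μ.measurePreserving_homeomorphUnitSphereProd.lintegral_comp_emb
          (Homeomorph.measurableEmbedding _) (f ∘ Subtype.val ∘ Prod.snd)
        simpa using this
    _ = μ.toSphere Set.univ * ∫⁻ s : Set.Ioi (0 : ℝ), f s
          ∂.volumeIoiPow (Module.finrank ℝ (Eucl d) - 1) := by
        rw [lintegral_prod _ (by fun_prop)]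
        simp [mul_comm]
    _ = _ := by
        rw [hfin, Measure.volumeIoiPow, lintegral_withDensity_eq_lintegral_mul _ (by fun_prop)
          (by fun_prop), ← lintegral_subtype_comap measurableSet_Ioi]
        rfl

lemma toSphere_univ_ne_zero (hd : 0 < d) : (volume : Measure (Eucl d)).toSphere Set.univ ≠ 0 := by
  have : Nonempty (Fin d) := ⟨⟨0, hd⟩⟩
  rw [Measure.toSphere_apply_univ]
  simp [hd.ne', (Metric.measure_ball_pos volume (0 : Eucl d) one_pos).ne']

/-- The reciprocal of the area of the unit sphere. -/
def invSphereArea (d : ℕ) : ℝ≥0∞ := ((volume : Measure (Eucl d)).toSphere Set.univ)⁻¹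

lemma invSphereArea_ne_top (hd : 0 < d) : invSphereArea d ≠ ⊤ :=
  ENNReal.inv_ne_top.2 (toSphere_univ_ne_zero hd)

lemma lintegral_Ioi_pow_mul (hd : 0 < d) {f : ℝ → ℝ≥0∞} (hf : Measurable f) :
    ∫⁻ s in Set.Ioi (0 : ℝ), ENNReal.ofReal (s ^ (d - 1)) * f s
      = invSphereArea d * ∫⁻ x : Eucl d, f ‖x‖ := by
  rw [lintegral_fun_norm hd hf, invSphereArea, ← mul_assoc,
    ENNReal.inv_mul_cancel (toSphere_univ_ne_zero hd) (measure_ne_top _ _), one_mul]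

/-- The fundamental theorem of calculus from infinity, together with `r^n ≤ s^n` for `s > r`. -/
lemma pow_mul_enorm_le_lintegral_Ioi {F : Type*} [NormedAddCommGroup F] [NormedSpace ℝ F]
    [CompleteSpace F] {q q' : ℝ → F} (hq : ∀ s, HasDerivAt q (q' s) s) (hc : Continuous q')
    (h0 : Tendsto q atTop (𝓝 0)) (n : ℕ) {r : ℝ} (hr : 0 ≤ r) :
    ENNReal.ofReal (r ^ n) * ‖q r‖ₑ ≤
      ∫⁻ s in Set.Ioi (0 : ℝ), ENNReal.ofReal (s ^ n) * ‖q' s‖ₑ := by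
  have h1 : ‖q r‖ₑ ≤ ∫⁻ s in Set.Ioi r, ‖q' s‖ₑ := by
    by_cases hfin : ∫⁻ s in Set.Ioi r, ‖q' s‖ₑ = ⊤
    · rw [hfin]; exact le_top
    have hi : IntegrableOn q' (Set.Ioi r) :=
      ⟨hc.aestronglyMeasurable, lt_top_iff_ne_top.2 hfin⟩
    have := integral_Ioi_of_hasDerivAt_of_tendsto' (fun x _ => hq x) hi h0
    have h2 : ‖q r‖ₑ = ‖∫ s in Set.Ioi r, q' s‖ₑ := by rw [this, zero_sub, enorm_neg]
    rw [h2]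
    exact enorm_integral_le_lintegral_enorm _
  calc ENNReal.ofReal (r ^ n) * ‖q r‖ₑ
      ≤ ENNReal.ofReal (r ^ n) * ∫⁻ s in Set.Ioi r, ‖q' s‖ₑ := by gcongr
    _ = ∫⁻ s in Set.Ioi r, ENNReal.ofReal (r ^ n) * ‖q' s‖ₑ :=
        (lintegral_const_mul' _ _ ENNReal.ofReal_ne_top).symm
    _ ≤ ∫⁻ s in Set.Ioi r, ENNReal.ofReal (s ^ n) * ‖q' s‖ₑ := by
        refine setLIntegral_mono' measurableSet_Ioi fun s hs => ?_
        gcongr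
        exact le_of_lt hs
    _ ≤ _ := lintegral_mono_set (Set.Ioi_subset_Ioi hr)

lemma tendsto_smul_cocompact {e : Eucl d} (he : e ≠ 0) :
    Tendsto (fun s : ℝ => s • e) atTop (cocompact (Eucl d)) := by
  rw [← Metric.cobounded_eq_cocompact, ← tendsto_norm_atTop_iff_cobounded]
  simp_rw [norm_smul]
  exact tendsto_norm_atTop_atTop.atTop_mul_const (norm_pos_iff.2 he)

section

variable {F : Type*} [NormedAddCommGroup F] [NormedSpace ℝ F]

lemma hasDerivAt_along {h : Eucl d → F} {G : Eucl d → Eucl d →L[ℝ] F}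
    (hG : ∀ x, HasFDerivAt h (G x) x) (e : Eucl d) (s : ℝ) :
    HasDerivAt (fun s : ℝ => h (s • e)) (G (s • e) e) s := by
  have h1 : HasDerivAt (fun s : ℝ => s • e) e s := by
    simpa using (hasDerivAt_id s).smul_const e
  exact (hG (s • e)).comp_hasDerivAt s h1

variable {h : Eucl d → F} {G₁ : Eucl d → Eucl d →L[ℝ] F}
  {G₂ : Eucl d → Eucl d →L[ℝ] Eucl d →L[ℝ] F}

/-- Along rays with directions of equal length a radial function has the same profile, hence the
same derivative. This turns an integral along one fixed ray into an integral over the whole space.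
-/
lemma IsRadialFun.deriv_along_eq (hr : IsRadialFun h) (hG : ∀ x, HasFDerivAt h (G₁ x) x)
    {e e' : Eucl d} (he : ‖e‖ = ‖e'‖) (s : ℝ) : G₁ (s • e) e = G₁ (s • e') e' := by
  refine (hasDerivAt_along hG e s).unique ?_
  have : (fun s : ℝ => h (s • e)) = fun s : ℝ => h (s • e') :=
    funext fun s => hr _ _ (by rw [norm_smul, norm_smul, he])
  rw [this]
  exact hasDerivAt_along hG e' s

lemma hasDerivAt_along_apply (hG' : ∀ x, HasFDerivAt G₁ (G₂ x) x) (e : Eucl d) (s : ℝ) :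
    HasDerivAt (fun s : ℝ => G₁ (s • e) e) (G₂ (s • e) e e) s := by
  simpa using (hasDerivAt_along hG' e s).clm_apply (hasDerivAt_const s e)

lemma IsRadialFun.deriv2_along_eq (hr : IsRadialFun h) (hG : ∀ x, HasFDerivAt h (G₁ x) x)
    (hG' : ∀ x, HasFDerivAt G₁ (G₂ x) x) {e e' : Eucl d} (he : ‖e‖ = ‖e'‖) (s : ℝ) :
    G₂ (s • e) e e = G₂ (s • e') e' e' := by
  refine (hasDerivAt_along_apply hG' e s).unique ?_
  rw [funext (hr.deriv_along_eq hG he)]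
  exact hasDerivAt_along_apply hG' e' s

end

lemma exists_norm_eq_one (hd : 0 < d) : ∃ e : Eucl d, ‖e‖ = 1 :=
  ⟨EuclideanSpace.single ⟨0, hd⟩ 1, by simp⟩

lemma norm_inv_norm_smul {x : Eucl d} (hx : x ≠ 0) : ‖‖x‖⁻¹ • x‖ = 1 := by
  rw [norm_smul, norm_inv, norm_norm, inv_mul_cancel₀ (norm_ne_zero_iff.2 hx)]

lemma norm_smul_inv_norm_smul {x : Eucl d} (hx : x ≠ 0) : ‖x‖ • ‖x‖⁻¹ • x = x := by
  rw [smul_smul, mul_inv_cancel₀ (norm_ne_zero_iff.2 hx), one_smul]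

lemma ae_ne_zero (hd : 0 < d) : ∀ᵐ x : Eucl d, x ≠ 0 := by
  have : Nonempty (Fin d) := ⟨⟨0, hd⟩⟩
  simp [ae_iff]

section decay

variable {h : Eucl d → ℂ} {G₁ : Eucl d → Eucl d →L[ℝ] ℂ}
  {G₂ : Eucl d → Eucl d →L[ℝ] Eucl d →L[ℝ] ℂ}

/-- A decay bound for a function of the norm in terms of its radial derivative. -/
lemma pow_mul_enorm_le_lintegral_powWeight (hd : 1 < d) {q q' : ℝ → ℂ}
    (hq : ∀ s, HasDerivAt q (q' s) s) (hc : Continuous q') (h0 : Tendsto q atTop (𝓝 0))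
    {g : Eucl d → ℝ≥0∞} (hg : ∀ x, x ≠ 0 → ‖q' ‖x‖‖ₑ ≤ g x) {r : ℝ} (hr : 0 ≤ r) :
    ENNReal.ofReal (r ^ (d - 2)) * ‖q r‖ₑ ≤
      invSphereArea d * ∫⁻ x, powWeight 1 x * g x := by
  have hd0 : 0 < d := by omega
  refine (pow_mul_enorm_le_lintegral_Ioi hq hc h0 (d - 2) hr).trans ?_
  -- The polar Jacobian is `s^(d-1)`; the missing power is the source of the weight `1 / |x|`.
  have h1 : ∫⁻ s in Set.Ioi (0 : ℝ), ENNReal.ofReal (s ^ (d - 2)) * ‖q' s‖ₑ =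
      ∫⁻ s in Set.Ioi (0 : ℝ), ENNReal.ofReal (s ^ (d - 1)) * (‖(1 / s ^ 1 : ℝ)‖ₑ * ‖q' s‖ₑ) := by
    refine setLIntegral_congr_fun measurableSet_Ioi fun s (hs : 0 < s) => ?_
    rw [← mul_assoc, Real.enorm_of_nonneg (by positivity), ← ENNReal.ofReal_mul (by positivity)]
    congr 2
    rw [show d - 1 = d - 2 + 1 by omega, pow_succ]
    field_simp
  rw [h1, lintegral_Ioi_pow_mul hd0 (f := fun s => ‖(1 / s ^ 1 : ℝ)‖ₑ * ‖q' s‖ₑ)]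
  · refine mul_le_mul' le_rfl ?_
    refine lintegral_mono_ae ?_
    filter_upwards [ae_ne_zero hd0] with x hx
    exact mul_le_mul_right (hg x hx) _
  · have := hc.measurable
    fun_prop

lemma IsRadialFun.pow_mul_enorm_le (hd : 1 < d) (hr : IsRadialFun h)
    (hG : ∀ x, HasFDerivAt h (G₁ x) x) (hc : Continuous G₁)
    (h0 : Tendsto h (cocompact _) (𝓝 0)) (x : Eucl d) :
    ENNReal.ofReal (‖x‖ ^ (d - 2)) * ‖h x‖ₑ ≤
      invSphereArea d * ∫⁻ y, powWeight 1 y * ‖G₁ y‖ₑ := by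
  obtain ⟨e, he⟩ := exists_norm_eq_one (d := d) (by omega)
  have hq := pow_mul_enorm_le_lintegral_powWeight hd (q := fun s => h (s • e))
    (q' := fun s => G₁ (s • e) e) (hasDerivAt_along hG e) (by fun_prop)
    (h0.comp (tendsto_smul_cocompact (by rintro rfl; simp at he))) (g := fun y => ‖G₁ y‖ₑ)
    (fun y hy => ?_) (norm_nonneg x)
  · refine le_trans (le_of_eq ?_) hq
    congr 2
    exact hr _ _ (by rw [norm_smul, he]; simp)
  · rw [← hr.deriv_along_eq hG ((norm_inv_norm_smul hy).trans he.symm), norm_smul_inv_norm_smul hy]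
    refine (ContinuousLinearMap.le_opENorm _ _).trans ?_
    rw [← ofReal_norm (‖y‖⁻¹ • y), norm_inv_norm_smul hy]
    simp

/-- The radial derivative is again a function of `|x|` away from the origin, and the derivative of
its profile is `G₂` evaluated twice on a unit vector. -/
lemma IsRadialFun.pow_mul_enorm_radialDeriv_le (hd : 1 < d) (hr : IsRadialFun h)
    (hG : ∀ x, HasFDerivAt h (G₁ x) x) (hG' : ∀ x, HasFDerivAt G₁ (G₂ x) x) (hc : Continuous G₂)
    (h0 : Tendsto G₁ (cocompact _) (𝓝 0)) {x : Eucl d} (hx : x ≠ 0) :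
    ENNReal.ofReal (‖x‖ ^ (d - 2)) * ‖G₁ x (‖x‖⁻¹ • x)‖ₑ ≤
      invSphereArea d * ∫⁻ y, powWeight 1 y * ‖G₂ y‖ₑ := by
  obtain ⟨e, he⟩ := exists_norm_eq_one (d := d) (by omega)
  have h0' : Tendsto (fun s : ℝ => G₁ (s • e) e) atTop (𝓝 0) := by
    have := (ContinuousLinearMap.apply ℝ ℂ e).continuous.tendsto 0 |>.comp
      (h0.comp (tendsto_smul_cocompact (e := e) (by rintro rfl; simp at he)))
    rw [map_zero] at this
    exact this
  have hq := pow_mul_enorm_le_lintegral_powWeight hd (q := fun s => G₁ (s • e) e)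
    (q' := fun s => G₂ (s • e) e e) (hasDerivAt_along_apply hG' e) (by fun_prop)
    h0' (g := fun y => ‖G₂ y‖ₑ) (fun y hy => ?_) (norm_nonneg x)
  · refine le_trans (le_of_eq ?_) hq
    congr 2
    rw [← hr.deriv_along_eq hG ((norm_inv_norm_smul hx).trans he.symm), norm_smul_inv_norm_smul hx]
  · have h1 : ‖(‖y‖⁻¹ • y)‖ₑ = 1 := by
      rw [← ofReal_norm (‖y‖⁻¹ • y), norm_inv_norm_smul hy]; simp
    rw [← hr.deriv2_along_eq hG hG' ((norm_inv_norm_smul hy).trans he.symm),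
      norm_smul_inv_norm_smul hy]
    refine (ContinuousLinearMap.le_opENorm _ _).trans ?_
    rw [h1, mul_one]
    refine (ContinuousLinearMap.le_opENorm _ _).trans ?_
    rw [h1, mul_one]

/-- The profile bound is applied to `|q|²`, whose derivative is twice the real inner product of `q`
and `q'`. The power `d - 1` matches the polar Jacobian, so no weight remains and Cauchy-Schwarz
applies. -/
lemma IsRadialFun.sq_le_eLpNorm_mul (hd : 0 < d) (hr : IsRadialFun h)
    (hG : ∀ x, HasFDerivAt h (G₁ x) x) (hc : Continuous G₁)
    (h0 : Tendsto h (cocompact _) (𝓝 0)) (x : Eucl d) :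
    ENNReal.ofReal (‖x‖ ^ (d - 1)) * ‖h x‖ₑ ^ 2 ≤
      2 * invSphereArea d * (eLpNorm h 2 volume * eLpNorm G₁ 2 volume) := by
  obtain ⟨e, he⟩ := exists_norm_eq_one hd
  have hhc : Continuous h := continuous_iff_continuousAt.2 fun x => (hG x).continuousAt
  have hq := fun s => (hasDerivAt_along hG e s).norm_sq
  have h0' : Tendsto (fun s : ℝ => ‖h (s • e)‖ ^ 2) atTop (𝓝 0) := by
    have := (h0.comp (tendsto_smul_cocompact (e := e) (by rintro rfl; simp at he))).norm.pow 2
    simpa using this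
  have hb := pow_mul_enorm_le_lintegral_Ioi hq (by fun_prop) h0' (d - 1) (norm_nonneg x)
  have hx : h (‖x‖ • e) = h x := hr _ _ (by rw [norm_smul, he]; simp)
  rw [hx, Real.enorm_of_nonneg (by positivity), ENNReal.ofReal_pow (norm_nonneg (h x)), ofReal_norm]
    at hb
  refine hb.trans ?_
  calc ∫⁻ s in Set.Ioi (0 : ℝ), ENNReal.ofReal (s ^ (d - 1)) *
        ‖2 * inner ℝ (h (s • e)) (G₁ (s • e) e)‖ₑ
      ≤ ∫⁻ s in Set.Ioi (0 : ℝ), ENNReal.ofReal (s ^ (d - 1)) *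
        (2 * (‖h (s • e)‖ₑ * ‖G₁ (s • e) e‖ₑ)) := by
        gcongr with s
        rw [enorm_mul]
        gcongr
        · simp [Real.enorm_of_nonneg]
        · simp only [← ofReal_norm]
          rw [← ENNReal.ofReal_mul (norm_nonneg _)]
          exact ENNReal.ofReal_le_ofReal (norm_inner_le_norm _ _)
    _ = invSphereArea d * ∫⁻ y : Eucl d, 2 * (‖h (‖y‖ • e)‖ₑ * ‖G₁ (‖y‖ • e) e‖ₑ) :=
        lintegral_Ioi_pow_mul hd (f := fun s => 2 * (‖h (s • e)‖ₑ * ‖G₁ (s • e) e‖ₑ))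
          (by
            have : Continuous fun s : ℝ => ‖h (s • e)‖ₑ := by fun_prop
            have h2 : Continuous fun s : ℝ => ‖G₁ (s • e) e‖ₑ := by fun_prop
            exact (this.measurable.mul h2.measurable).const_mul 2)
    _ = 2 * invSphereArea d * ∫⁻ y : Eucl d, ‖h (‖y‖ • e)‖ₑ * ‖G₁ (‖y‖ • e) e‖ₑ := by
        rw [lintegral_const_mul' _ _ (by simp), ← mul_assoc, mul_comm 2]
    _ ≤ 2 * invSphereArea d * ∫⁻ y : Eucl d, ‖h y‖ₑ * ‖G₁ y‖ₑ := by
        refine mul_le_mul' le_rfl ?_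
        refine lintegral_mono_ae ?_
        filter_upwards [ae_ne_zero hd] with y hy
        gcongr
        · exact (congrArg enorm (hr _ _ (by rw [norm_smul, he]; simp))).le
        · rw [← hr.deriv_along_eq hG ((norm_inv_norm_smul hy).trans he.symm),
            norm_smul_inv_norm_smul hy]
          refine (ContinuousLinearMap.le_opENorm _ _).trans ?_
          rw [← ofReal_norm (‖y‖⁻¹ • y), norm_inv_norm_smul hy]
          simp
    _ ≤ _ := by
        gcongr
        have := ENNReal.lintegral_mul_le_Lp_mul_Lq (volume : Measure (Eucl d))
          Real.HolderConjugate.two_two hhc.enorm.measurable.aemeasurable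
          hc.enorm.measurable.aemeasurable
        refine this.trans (le_of_eq ?_)
        simp [eLpNorm_eq_lintegral_rpow_enorm_toReal]

end decay

end

/-! ### A Littlewood-Paley block as a convolution with a dilated Schwartz kernel. -/

section

open FourierTransform

variable {d : ℕ} {φ : Eucl d → ℂ}

lemma IsLPCutoff.hasCompactSupport (hφ : IsLPCutoff φ) : HasCompactSupport φ := by
  refine HasCompactSupport.intro (isCompact_closedBall (0 : Eucl d) 2) fun x hx => ?_
  exact hφ.eq_zero x (by simpa using hx)

lemma IsLPCutoff.hasCompactSupport_smul (hφ : IsLPCutoff φ) {c : ℝ} (hc : c ≠ 0) :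
    HasCompactSupport fun η : Eucl d => φ (c • η) :=
  hφ.hasCompactSupport.comp_homeomorph (Homeomorph.smulOfNeZero c hc)

lemma IsLPCutoff.contDiff_smul (hφ : IsLPCutoff φ) (c : ℝ) :
    ContDiff ℝ ∞ fun η : Eucl d => φ (c • η) :=
  hφ.smooth.comp (contDiff_const_smul c)

/-- The symbol of the Littlewood-Paley projection `lpProj φ j`. -/
def lpSymbol (φ : Eucl d → ℂ) (j : ℤ) (η : Eucl d) : ℂ :=
  φ ((2 * Real.pi / (2 : ℝ) ^ j) • η) - φ ((2 * Real.pi / (2 : ℝ) ^ (j - 1)) • η)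

/-- A symbol at frequency `l` which is `1` on the support of `lpSymbol φ j` when `l = 2 ^ j`. -/
def fatSymbol (φ : Eucl d → ℂ) (l : ℝ) (η : Eucl d) : ℂ := φ ((Real.pi / l) • η)

lemma IsLPCutoff.hasTemperateGrowth_smul (hφ : IsLPCutoff φ) {c : ℝ} (hc : c ≠ 0) :
    (fun η : Eucl d => φ (c • η)).HasTemperateGrowth :=
  (hφ.hasCompactSupport_smul hc).hasTemperateGrowth (hφ.contDiff_smul c)

lemma IsLPCutoff.hasTemperateGrowth_lpSymbol (hφ : IsLPCutoff φ) (j : ℤ) :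
    (lpSymbol φ j).HasTemperateGrowth :=
  (hφ.hasTemperateGrowth_smul (by positivity)).sub (hφ.hasTemperateGrowth_smul (by positivity))

lemma IsLPCutoff.hasTemperateGrowth_fatSymbol (hφ : IsLPCutoff φ) {l : ℝ} (hl : 0 < l) :
    (fatSymbol φ l).HasTemperateGrowth :=
  hφ.hasTemperateGrowth_smul (by positivity)

lemma lpSymbol_eq_zero (hφ : IsLPCutoff φ) {j : ℤ} {η : Eucl d}
    (h : 2 < 2 * Real.pi / (2 : ℝ) ^ j * ‖η‖) : lpSymbol φ j η = 0 := by
  have h1 : ‖(2 * Real.pi / (2 : ℝ) ^ j) • η‖ = 2 * Real.pi / (2 : ℝ) ^ j * ‖η‖ := by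
    rw [norm_smul, Real.norm_of_nonneg (by positivity)]
  have h2 : ‖(2 * Real.pi / (2 : ℝ) ^ (j - 1)) • η‖ = 2 * (2 * Real.pi / (2 : ℝ) ^ j * ‖η‖) := by
    rw [norm_smul, Real.norm_of_nonneg (by positivity), zpow_sub_one₀ two_ne_zero]
    field_simp
  rw [lpSymbol, hφ.eq_zero _ (by rwa [h1]), hφ.eq_zero _ (by rw [h2]; linarith), sub_zero]

/-- With `ξ = 2π η`, the symbol of the block vanishes for `|ξ| > 2 · 2^j`, while the wider one is
`φ(ξ / (2 · 2^j))`, which is `1` for `|ξ| ≤ 2 · 2^j`. -/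
lemma lpSymbol_mul_fatSymbol (hφ : IsLPCutoff φ) (j : ℤ) :
    lpSymbol φ j * fatSymbol φ (2 ^ j) = lpSymbol φ j := by
  ext η
  simp only [Pi.mul_apply]
  rcases lt_or_ge 2 (2 * Real.pi / (2 : ℝ) ^ j * ‖η‖) with h | h
  · rw [lpSymbol_eq_zero hφ h, zero_mul]
  · rw [fatSymbol, hφ.eq_one, mul_one]
    rw [norm_smul, Real.norm_of_nonneg (by positivity)]
    have : Real.pi / (2 : ℝ) ^ j * ‖η‖ = (2 * Real.pi / (2 : ℝ) ^ j * ‖η‖) / 2 := by ring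
    rw [this]
    linarith

lemma lpProj_eq (j : ℤ) (W : 𝓢'(Eucl d, ℂ)) :
    lpProj φ j W = TemperedDistribution.fourierMultiplierCLM ℂ (lpSymbol φ j) W := rfl

lemma fourierMultiplier_lpProj (hφ : IsLPCutoff φ) (j : ℤ) (W : 𝓢'(Eucl d, ℂ)) :
    TemperedDistribution.fourierMultiplierCLM ℂ (fatSymbol φ (2 ^ j)) (lpProj φ j W)
      = lpProj φ j W := by
  rw [lpProj_eq, TemperedDistribution.fourierMultiplierCLM_fourierMultiplierCLM_apply
    (hφ.hasTemperateGrowth_lpSymbol j) (hφ.hasTemperateGrowth_fatSymbol (by positivity)),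
    lpSymbol_mul_fatSymbol hφ]

/-- The symbol `fatSymbol φ 1` as a Schwartz function. -/
def fatSchwartz (hφ : IsLPCutoff φ) : 𝓢(Eucl d, ℂ) :=
  (hφ.hasCompactSupport_smul Real.pi_ne_zero).toSchwartzMap (hφ.contDiff_smul Real.pi)

lemma fatSchwartz_apply (hφ : IsLPCutoff φ) (η : Eucl d) :
    fatSchwartz hφ η = φ (Real.pi • η) := rfl

/-- The convolution kernel of the Fourier multiplier `fatSymbol φ 1`. -/
def lpKernel (hφ : IsLPCutoff φ) : 𝓢(Eucl d, ℂ) := 𝓕⁻ (fatSchwartz hφ)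

lemma integrable_fatSymbol (hφ : IsLPCutoff φ) {l : ℝ} (hl : 0 < l) :
    Integrable (fatSymbol φ l) := by
  have : Real.pi / l ≠ 0 := by positivity
  exact (hφ.contDiff_smul _).continuous.integrable_of_hasCompactSupport
    (hφ.hasCompactSupport_smul this)

lemma integral_fourierChar_mul_fatSymbol (hφ : IsLPCutoff φ) {l : ℝ} (hl : 0 < l) (z : Eucl d) :
    ∫ η, Real.fourierChar (inner ℝ η z) • fatSymbol φ l η
      = dilatedKernel 0 l (lpKernel hφ) z := by
  rw [dilatedKernel, lpKernel, SchwartzMap.fourierInv_coe, Real.fourierInv_eq]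
  have h := Measure.integral_comp_inv_smul (volume : Measure (Eucl d))
    (fun v : Eucl d => Real.fourierChar (inner ℝ v (l • z)) • fatSchwartz hφ v) l
  rw [finrank_euclideanSpace_fin, abs_of_pos (by positivity)] at h
  rw [add_zero, ← h]
  congr with η
  rw [inner_smul_left, inner_smul_right, fatSchwartz_apply, fatSymbol, smul_smul]
  simp only [RCLike.conj_to_real]
  rw [inv_mul_cancel_left₀ hl.ne', div_eq_mul_inv]

lemma fourier_smulLeft_fatSymbol (hφ : IsLPCutoff φ) {l : ℝ} (hl : 0 < l) (ψ : 𝓢(Eucl d, ℂ))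
    (x : Eucl d) :
    (𝓕 (SchwartzMap.smulLeftCLM ℂ (fatSymbol φ l) (𝓕⁻ ψ))) x
      = ∫ y, ψ y * dilatedKernel 0 l (lpKernel hφ) (y - x) := by
  set a : Eucl d → ℂ := fun η => Real.fourierChar (-inner ℝ η x) • fatSymbol φ l η
  have ha : Integrable a := by
    refine (integrable_fatSymbol hφ hl).norm.mono' ?_ (Eventually.of_forall fun η => ?_)
    · have h1 : Continuous fun η : Eucl d => Real.fourierChar (-inner ℝ η x) :=
        Real.continuous_fourierChar.comp (by fun_prop)
      have h2 : Continuous (fatSymbol φ l) := (hφ.contDiff_smul _).continuous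
      exact (h1.smul h2).aestronglyMeasurable
    · simp [a]
  have h1 : (𝓕 (SchwartzMap.smulLeftCLM ℂ (fatSymbol φ l) (𝓕⁻ ψ))) x
      = ∫ η, (𝓕⁻ (ψ : Eucl d → ℂ) η) • a η := by
    rw [SchwartzMap.fourier_coe, Real.fourier_eq]
    congr with η
    rw [SchwartzMap.smulLeftCLM_apply_apply (hφ.hasTemperateGrowth_fatSymbol hl),
      SchwartzMap.fourierInv_coe]
    simp only [a, Circle.smul_def, smul_eq_mul]
    ring
  -- The multiplication formula moves the transform from `ψ` to `a`; the pairing `-innerₗ` is the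
  -- one whose Fourier integral is the inverse transform.
  have h2 : ∫ η, (𝓕⁻ (ψ : Eucl d → ℂ) η) • a η = ∫ y, ψ y • 𝓕⁻ a y :=
    VectorFourier.integral_fourierIntegral_smul_eq_flip (L := -innerₗ (Eucl d))
      Real.continuous_fourierChar (by
        have : Continuous fun p : Eucl d × Eucl d => -inner ℝ p.1 p.2 := by fun_prop
        simpa using this) ψ.integrable ha |>.trans
      (by
        congr with y
        rw [Real.fourierInv_eq, VectorFourier.fourierIntegral]
        simp [real_inner_comm])
  rw [h1, h2]
  congr with y
  rw [smul_eq_mul, ← integral_fourierChar_mul_fatSymbol hφ hl, Real.fourierInv_eq]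
  congr 2 with η
  simp only [a]
  rw [smul_smul, ← AddChar.map_add_eq_mul, inner_sub_right, sub_eq_add_neg]

lemma exists_norm_le_schwartz {F : Type*} [NormedAddCommGroup F] [NormedSpace ℝ F]
    (k : 𝓢(Eucl d, F)) : ∃ M, ∀ x, ‖k x‖ ≤ M := by
  obtain ⟨C, hC⟩ := k.decay 0 0
  exact ⟨C, fun x => by simpa using hC.2 x⟩

lemma tendsto_cocompact_schwartz {F : Type*} [NormedAddCommGroup F] [NormedSpace ℝ F]
    (k : 𝓢(Eucl d, F)) : Tendsto k (cocompact _) (𝓝 0) :=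
  k.toZeroAtInfty.zero_at_infty'

section dilated

variable {F : Type*} [NormedAddCommGroup F] [NormedSpace ℝ F] (m : ℕ) {l : ℝ} (k : 𝓢(Eucl d, F))

lemma continuous_dilatedKernel (l : ℝ) : Continuous (dilatedKernel m l k) := by
  have := k.continuous
  unfold dilatedKernel
  fun_prop

lemma exists_norm_dilatedKernel_le (l : ℝ) : ∃ M, ∀ x, ‖dilatedKernel m l k x‖ ≤ M := by
  obtain ⟨M, hM⟩ := exists_norm_le_schwartz k
  refine ⟨‖l ^ (d + m)‖ * M, fun x => ?_⟩
  rw [dilatedKernel, norm_smul]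
  gcongr
  exact hM _

lemma tendsto_dilatedKernel (hl : 0 < l) : Tendsto (dilatedKernel m l k) (cocompact _) (𝓝 0) := by
  have h1 : Tendsto (fun x : Eucl d => l • x) (cocompact _) (cocompact _) :=
    (Homeomorph.smulOfNeZero l hl.ne').isClosedEmbedding.tendsto_cocompact
  have h2 := ((tendsto_cocompact_schwartz k).comp h1).const_smul (l ^ (d + m))
  rw [smul_zero] at h2
  exact h2

end dilated

/-- The embedding of `L^p` into tempered distributions is injective, so the infimum runs over a
single function and is attained. -/
lemma exists_toTemperedDistribution_eq_of_distLpNorm_ne_top {p : ℝ≥0∞} [Fact (1 ≤ p)]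
    {u : 𝓢'(Eucl d, ℂ)} (h : distLpNorm p u ≠ ⊤) :
    ∃ g : Lp ℂ p (volume : Measure (Eucl d)),
      MeasureTheory.Lp.toTemperedDistribution g = u ∧ ‖g‖ₑ = distLpNorm p u := by
  have h1 : ∃ g : Lp ℂ p (volume : Measure (Eucl d)),
      MeasureTheory.Lp.toTemperedDistribution g = u := by
    by_contra hcon
    push Not at hcon
    exact h (by simp [distLpNorm, hcon])
  obtain ⟨g, hg⟩ := h1
  refine ⟨g, hg, le_antisymm (le_iInf₂ fun g' hg' => ?_) (iInf₂_le g hg)⟩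
  have hker := LinearMap.ker_eq_bot.1 (Lp.ker_toTemperedDistributionCLM_eq_bot (F := ℂ)
    (μ := (volume : Measure (Eucl d))) (p := p))
  have : g = g' := hker (by simpa using hg.trans hg'.symm)
  rw [this]

/-- The function convolved is the representative `g` of the block itself, so later bounds involve
only the norm of the block. -/
lemma lpProj_apply_eq_integral (hφ : IsLPCutoff φ) {j : ℤ} {W : 𝓢'(Eucl d, ℂ)}
    {g : Lp ℂ 1 (volume : Measure (Eucl d))}
    (hg : MeasureTheory.Lp.toTemperedDistribution g = lpProj φ j W) (ψ : 𝓢(Eucl d, ℂ)) :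
    lpProj φ j W ψ
      = ∫ y, ψ y * convKernel (dilatedKernel 0 (2 ^ j) (lpKernel hφ)) g y := by
  have hl : (0 : ℝ) < 2 ^ j := by positivity
  have hgi : Integrable (g : Eucl d → ℂ) := memLp_one_iff_integrable.1 (Lp.memLp g)
  obtain ⟨M, hM⟩ := exists_norm_dilatedKernel_le 0 (lpKernel hφ) (2 ^ j)
  set K := dilatedKernel 0 ((2 : ℝ) ^ j) (lpKernel hφ)
  have hK : Continuous K := continuous_dilatedKernel 0 (lpKernel hφ) _
  rw [← fourierMultiplier_lpProj hφ, TemperedDistribution.fourierMultiplierCLM_apply_apply, ← hg,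
    Lp.toTemperedDistribution_apply]
  simp_rw [fourier_smulLeft_fatSymbol hφ hl, convKernel, smul_eq_mul, ← integral_mul_const,
    ← integral_const_mul]
  rw [integral_integral_swap]
  · congr with y
    congr with x
    ring
  · have h1 : Integrable (fun p : Eucl d × Eucl d => g p.1 * ψ p.2) (volume.prod volume) :=
      hgi.mul_prod ψ.integrable
    refine (h1.norm.mul_const M).mono' ?_ (Eventually.of_forall fun p => ?_)
    · have h2 : Continuous fun p : Eucl d × Eucl d => ψ p.2 * K (p.2 - p.1) := by
        have := ψ.continuous
        fun_prop
      exact h2.aestronglyMeasurable.mul hgi.1.comp_fst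
    · simp only [Function.uncurry, norm_mul]
      calc _ = ‖g p.1‖ * ‖ψ p.2‖ * ‖K (p.2 - p.1)‖ := by ring
        _ ≤ _ := by gcongr; exact hM _

end

/-! ### Radial symmetry of the blocks and their weighted bounds. -/

section

open FourierTransform

variable {d : ℕ} {φ : Eucl d → ℂ}

lemma lpSymbol_comp_isometry (hφ : IsLPCutoff φ) (j : ℤ) (A : Eucl d ≃ₗᵢ[ℝ] Eucl d) :
    lpSymbol φ j ∘ A = lpSymbol φ j := by
  ext η
  simp only [Function.comp, lpSymbol]
  congr 1 <;> exact hφ.radial _ _ (by rw [norm_smul, norm_smul, A.norm_map])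

lemma fourier_comp_isometry (A : Eucl d ≃ₗᵢ[ℝ] Eucl d) (ψ : 𝓢(Eucl d, ℂ)) :
    𝓕 (SchwartzMap.compCLMOfContinuousLinearEquiv ℂ A.toContinuousLinearEquiv ψ)
      = SchwartzMap.compCLMOfContinuousLinearEquiv ℂ A.toContinuousLinearEquiv (𝓕 ψ) := by
  ext x
  rw [SchwartzMap.compCLMOfContinuousLinearEquiv_apply, SchwartzMap.fourier_coe,
    SchwartzMap.fourier_coe]
  exact Real.fourier_comp_linearIsometry A ψ x

lemma fourierInv_comp_isometry (A : Eucl d ≃ₗᵢ[ℝ] Eucl d) (ψ : 𝓢(Eucl d, ℂ)) :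
    𝓕⁻ (SchwartzMap.compCLMOfContinuousLinearEquiv ℂ A.toContinuousLinearEquiv ψ)
      = SchwartzMap.compCLMOfContinuousLinearEquiv ℂ A.toContinuousLinearEquiv (𝓕⁻ ψ) := by
  ext x
  rw [SchwartzMap.compCLMOfContinuousLinearEquiv_apply, SchwartzMap.fourierInv_coe,
    SchwartzMap.fourierInv_coe]
  exact Real.fourierInv_comp_linearIsometry A ψ x

lemma smulLeft_lpSymbol_comp_isometry (hφ : IsLPCutoff φ) (j : ℤ) (A : Eucl d ≃ₗᵢ[ℝ] Eucl d)
    (ψ : 𝓢(Eucl d, ℂ)) :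
    SchwartzMap.smulLeftCLM ℂ (lpSymbol φ j)
        (SchwartzMap.compCLMOfContinuousLinearEquiv ℂ A.toContinuousLinearEquiv ψ)
      = SchwartzMap.compCLMOfContinuousLinearEquiv ℂ A.toContinuousLinearEquiv
        (SchwartzMap.smulLeftCLM ℂ (lpSymbol φ j) ψ) := by
  rw [SchwartzMap.smulLeftCLM_compCLMOfContinuousLinearEquiv ℂ (hφ.hasTemperateGrowth_lpSymbol j)]
  congr 2
  exact congrArg _ (lpSymbol_comp_isometry hφ j A.symm)

lemma IsRadialDistribution.lpProj (hφ : IsLPCutoff φ) {W : 𝓢'(Eucl d, ℂ)}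
    (hW : IsRadialDistribution W) (j : ℤ) : IsRadialDistribution (lpProj φ j W) := by
  intro A ψ
  rw [lpProj_eq, TemperedDistribution.fourierMultiplierCLM_apply_apply,
    TemperedDistribution.fourierMultiplierCLM_apply_apply, fourierInv_comp_isometry,
    smulLeft_lpSymbol_comp_isometry hφ, fourier_comp_isometry, hW]

lemma exists_isometry_of_norm_eq {x y : Eucl d} (h : ‖x‖ = ‖y‖) :
    ∃ A : Eucl d ≃ₗᵢ[ℝ] Eucl d, A x = y :=
  ⟨(ℝ ∙ (x - y))ᗮ.reflection, Submodule.reflection_sub h⟩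

/-- A reflection carries `x` to any `y` of the same norm. Invariance of the distribution gives `h ∘
A = h` almost everywhere, and continuity gives it everywhere. -/
lemma IsRadialDistribution.isRadialFun {u : 𝓢'(Eucl d, ℂ)} (hu : IsRadialDistribution u)
    {h : Eucl d → ℂ} (hc : Continuous h) (hh : ∀ ψ : 𝓢(Eucl d, ℂ), u ψ = ∫ x, ψ x * h x) :
    IsRadialFun h := by
  intro x y hxy
  obtain ⟨A, hA⟩ := exists_isometry_of_norm_eq hxy
  suffices H : h ∘ A = h by rw [← hA]; exact (congrFun H x).symm
  have hc' : Continuous (h ∘ A) := hc.comp A.continuous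
  rw [← hc'.ae_eq_iff_eq volume hc]
  refine ae_eq_of_integral_contDiff_smul_eq hc'.locallyIntegrable hc.locallyIntegrable
    fun g hg hgc => ?_
  have hg₁ : HasCompactSupport (Complex.ofRealCLM ∘ g) := hgc.comp_left rfl
  have hg₂ : ContDiff ℝ ∞ (Complex.ofRealCLM ∘ g) := by fun_prop
  set ψ := hg₁.toSchwartzMap hg₂
  have hψ : ∀ x, ψ x = (g x : ℂ) := fun x => rfl
  have h1 := hu A.symm ψ
  rw [hh, hh] at h1
  have h2 : ∫ x, g x • (h ∘ A) x = ∫ x, (g (A.symm x)) • h x := by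
    have := A.measurePreserving.integral_comp A.toHomeomorph.measurableEmbedding
      (fun z => (g (A.symm z)) • h z)
    simpa using this
  rw [h2]
  simpa [hψ] using h1

/-- The properties of a Littlewood-Paley block `lpProj φ j W` which are used below: a bound `B`
for the weighted `L¹` norms at homogeneity `s` of the block and its derivatives. -/
structure IsBlock (s : ℕ) (u : 𝓢'(Eucl d, ℂ)) (B : ℝ≥0∞) (h : Eucl d → ℂ)
    (G₁ : Eucl d → Eucl d →L[ℝ] ℂ) (G₂ : Eucl d → Eucl d →L[ℝ] Eucl d →L[ℝ] ℂ) : Prop where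
  hasFDerivAt : ∀ x, HasFDerivAt h (G₁ x) x
  hasFDerivAt' : ∀ x, HasFDerivAt G₁ (G₂ x) x
  continuous : Continuous G₂
  tendsto : Tendsto h (cocompact _) (𝓝 0)
  tendsto' : Tendsto G₁ (cocompact _) (𝓝 0)
  apply_eq : ∀ ψ : 𝓢(Eucl d, ℂ), u ψ = ∫ x, ψ x * h x
  bound : ∫⁻ x, powWeight s x * ‖h x‖ₑ ≤ B
  bound₁ : ∫⁻ x, powWeight (s - 1) x * ‖G₁ x‖ₑ ≤ B
  bound₂ : ∫⁻ x, powWeight (s - 2) x * ‖G₂ x‖ₑ ≤ B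
  finite : ∫⁻ x, powWeight 1 x * ‖G₁ x‖ₑ ≠ ⊤

/-- The kernel with `m` derivatives is weighted by `|x|^(-(s-m))`, so the power of the frequency is
`s` for each of `m = 0, 1, 2`. -/
lemma exists_isBlock (hφ : IsLPCutoff φ) (hd : 1 < d) {s : ℕ} (hs : 2 ≤ s) (hs' : s < d) :
    ∃ C : ℝ≥0, ∀ (j : ℤ) (W : 𝓢'(Eucl d, ℂ)), distLpNorm 1 (lpProj φ j W) ≠ ⊤ →
      ∃ h G₁ G₂, IsBlock s (lpProj φ j W)
        (C * (ENNReal.ofReal (((2 : ℝ) ^ j) ^ s) * distLpNorm 1 (lpProj φ j W))) h G₁ G₂ := by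
  set κ := lpKernel hφ
  set κ₁ := SchwartzMap.fderivCLM ℝ (Eucl d) ℂ κ
  set κ₂ := SchwartzMap.fderivCLM ℝ (Eucl d) (Eucl d →L[ℝ] ℂ) κ₁
  have hκ₁ : ∀ x, HasFDerivAt κ (κ₁ x) x := fun x => κ.differentiableAt.hasFDerivAt
  have hκ₂ : ∀ x, HasFDerivAt κ₁ (κ₂ x) x := fun x => κ₁.differentiableAt.hasFDerivAt
  have hb : ∀ {F : Type} [NormedAddCommGroup F] [NormedSpace ℝ F] (k : 𝓢(Eucl d, F)) {a : ℕ},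
      a < d → ∃ C : ℝ≥0, ∀ y, ∫⁻ x, powWeight a x * ‖k (x - y)‖ₑ ≤ C := by
    intro F _ _ k a ha
    obtain ⟨M, hM⟩ := exists_norm_le_schwartz k
    exact exists_lintegral_powWeight_le k.integrable hM ha
  obtain ⟨C₀, hC₀⟩ := hb κ hs'
  obtain ⟨C₁, hC₁⟩ := hb κ₁ (by omega : s - 1 < d)
  obtain ⟨C₂, hC₂⟩ := hb κ₂ (by omega : s - 2 < d)
  -- This constant enters only the qualitative field `finite`, not the final bound.
  obtain ⟨C₃, hC₃⟩ := hb κ₁ (by omega : 1 < d)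
  refine ⟨C₀ + C₁ + C₂, fun j W hW => ?_⟩
  obtain ⟨g, hg, hgn⟩ := exists_toTemperedDistribution_eq_of_distLpNorm_ne_top hW
  rw [← hgn]
  have hgi : Integrable (g : Eucl d → ℂ) := memLp_one_iff_integrable.1 (Lp.memLp g)
  have hgn' : ‖g‖ₑ = ∫⁻ x, ‖g x‖ₑ := by
    rw [Lp.enorm_def, eLpNorm_one_eq_lintegral_enorm]
  have hl : (0 : ℝ) < 2 ^ j := by positivity
  set l : ℝ := 2 ^ j
  obtain ⟨M₀, hM₀⟩ := exists_norm_dilatedKernel_le 0 κ l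
  obtain ⟨M₁, hM₁⟩ := exists_norm_dilatedKernel_le 1 κ₁ l
  obtain ⟨M₂, hM₂⟩ := exists_norm_dilatedKernel_le 2 κ₂ l
  have hc₀ := continuous_dilatedKernel 0 κ l
  have hc₁ := continuous_dilatedKernel 1 κ₁ l
  have hc₂ := continuous_dilatedKernel 2 κ₂ l
  have hB : ∀ {C : ℝ≥0} {m a : ℕ} {I : ℝ≥0∞}, C ≤ C₀ + C₁ + C₂ → m + a = s →
      I ≤ ENNReal.ofReal (l ^ (m + a)) * C * ∫⁻ x, ‖g x‖ₑ →
      I ≤ ((C₀ + C₁ + C₂ : ℝ≥0) : ℝ≥0∞) * (ENNReal.ofReal (l ^ s) * ‖g‖ₑ) := by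
    intro C m a I hC hma hI
    refine hI.trans ?_
    rw [hma, hgn', ← mul_assoc, mul_comm (ENNReal.ofReal _) (C : ℝ≥0∞)]
    gcongr
  refine ⟨convKernel (dilatedKernel 0 l κ) g, convKernel (dilatedKernel 1 l κ₁) g,
    convKernel (dilatedKernel 2 l κ₂) g, ?_, ?_, ?_, ?_, ?_, ?_, ?_, ?_, ?_, ?_⟩
  · exact hasFDerivAt_convKernel (fun x => hasFDerivAt_dilatedKernel hκ₁ x) hc₁ hM₀ hM₁ hgi
  · exact hasFDerivAt_convKernel (fun x => hasFDerivAt_dilatedKernel hκ₂ x) hc₂ hM₁ hM₂ hgi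
  · exact continuous_convKernel hc₂ hM₂ hgi
  · exact tendsto_convKernel_cocompact hc₀ hM₀ (tendsto_dilatedKernel 0 κ hl) hgi
  · exact tendsto_convKernel_cocompact hc₁ hM₁ (tendsto_dilatedKernel 1 κ₁ hl) hgi
  · exact lpProj_apply_eq_integral hφ hg
  · exact hB (by rw [add_assoc]; exact le_self_add) (by omega : 0 + s = s)
      (lintegral_powWeight_convKernel_le hc₀
      (lintegral_powWeight_dilatedKernel_le hC₀ 0 hl) hgi)
  · exact hB (by rw [add_comm C₀, add_assoc]; exact le_self_add) (by omega : 1 + (s - 1) = s)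
      (lintegral_powWeight_convKernel_le hc₁
      (lintegral_powWeight_dilatedKernel_le hC₁ 1 hl) hgi)
  · exact hB le_add_self (by omega : 2 + (s - 2) = s)
      (lintegral_powWeight_convKernel_le hc₂
      (lintegral_powWeight_dilatedKernel_le hC₂ 2 hl) hgi)
  · refine ne_top_of_le_ne_top ?_ (lintegral_powWeight_convKernel_le hc₁
      (lintegral_powWeight_dilatedKernel_le hC₃ 1 hl) hgi)
    have := hgi.2.ne
    finiteness

end

/-! ### Convergence of the Littlewood-Paley series. -/

section

open FourierTransform

variable {d : ℕ} {φ : Eucl d → ℂ}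

lemma sum_Icc_neg_telescope (a : ℤ → ℂ) (N : ℕ) :
    ∑ j ∈ Finset.Icc (-(N : ℤ)) N, (a j - a (j - 1)) = a N - a (-(N : ℤ) - 1) := by
  induction N with
  | zero => simp
  | succ N ih =>
    have h : Finset.Icc (-((N + 1 : ℕ) : ℤ)) ((N + 1 : ℕ) : ℤ) =
        insert ((N : ℤ) + 1) (insert (-(N : ℤ) - 1) (Finset.Icc (-(N : ℤ)) N)) := by
      ext j
      simp only [Finset.mem_insert, Finset.mem_Icc]
      omega
    rw [h, Finset.sum_insert, Finset.sum_insert, ih]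
    · push_cast
      rw [show -((N : ℤ) + 1) - 1 = -(N : ℤ) - 1 - 1 by ring]
      ring_nf
    · simp
    · simp only [Finset.mem_insert, Finset.mem_Icc]
      omega

lemma sum_lpSymbol (φ : Eucl d → ℂ) (N : ℕ) (η : Eucl d) :
    ∑ j ∈ Finset.Icc (-(N : ℤ)) N, lpSymbol φ j η =
      φ ((2 * Real.pi / (2 : ℝ) ^ (N : ℤ)) • η)
        - φ ((2 * Real.pi / (2 : ℝ) ^ (-(N : ℤ) - 1)) • η) :=
  sum_Icc_neg_telescope (fun j => φ ((2 * Real.pi / (2 : ℝ) ^ j) • η)) N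

lemma exists_norm_sum_lpSymbol_le (hφ : IsLPCutoff φ) :
    ∃ M, ∀ (N : ℕ) (η : Eucl d), ‖∑ j ∈ Finset.Icc (-(N : ℤ)) N, lpSymbol φ j η‖ ≤ M := by
  obtain ⟨M, hM⟩ := hφ.hasCompactSupport.exists_bound_of_continuous hφ.smooth.continuous
  refine ⟨M + M, fun N η => ?_⟩
  rw [sum_lpSymbol]
  exact (norm_sub_le _ _).trans (add_le_add (hM _) (hM _))

/-- After telescoping, the sequence is eventually constant: for large `N` the high-frequency cutoff
equals `1` at `η` and the low-frequency one equals `0`. The excluded frequency zero is a null set.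
-/
lemma tendsto_sum_lpSymbol (hφ : IsLPCutoff φ) {η : Eucl d} (hη : η ≠ 0) :
    Tendsto (fun N : ℕ => ∑ j ∈ Finset.Icc (-(N : ℤ)) N, lpSymbol φ j η) atTop (𝓝 1) := by
  have hη' : 0 < ‖η‖ := norm_pos_iff.2 hη
  have hpow : Tendsto (fun N : ℕ => (2 : ℝ) ^ N) atTop atTop :=
    tendsto_pow_atTop_atTop_of_one_lt (by norm_num)
  refine tendsto_const_nhds.congr' ?_
  filter_upwards [hpow.eventually_ge_atTop (2 * Real.pi * ‖η‖),
    hpow.eventually_gt_atTop (2 / (4 * Real.pi * ‖η‖))] with N h1 h2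
  rw [sum_lpSymbol, hφ.eq_one, hφ.eq_zero, sub_zero]
  · rw [norm_smul, Real.norm_of_nonneg (by positivity), zpow_sub_one₀ two_ne_zero, zpow_neg,
      zpow_natCast]
    rw [div_lt_iff₀ (by positivity)] at h2
    field_simp
    nlinarith
  · rw [norm_smul, Real.norm_of_nonneg (by positivity), zpow_natCast, div_mul_eq_mul_div,
      div_le_one (by positivity)]
    exact h1

/-- The Littlewood-Paley projection of a Schwartz function. -/
def lpSchwartz (φ : Eucl d → ℂ) (j : ℤ) (f : 𝓢(Eucl d, ℂ)) : 𝓢(Eucl d, ℂ) :=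
  SchwartzMap.fourierMultiplierCLM ℂ (lpSymbol φ j) f

lemma lpProj_coe (hφ : IsLPCutoff φ) (j : ℤ) (f : 𝓢(Eucl d, ℂ)) :
    lpProj φ j (f : 𝓢'(Eucl d, ℂ)) = (lpSchwartz φ j f : 𝓢'(Eucl d, ℂ)) :=
  TemperedDistribution.fourierMultiplierCLM_toTemperedDistributionCLM_eq
    (hφ.hasTemperateGrowth_lpSymbol j) f

lemma fourier_lpSchwartz (hφ : IsLPCutoff φ) (j : ℤ) (f : 𝓢(Eucl d, ℂ)) (η : Eucl d) :
    𝓕 (lpSchwartz φ j f) η = lpSymbol φ j η * 𝓕 f η := by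
  rw [lpSchwartz, SchwartzMap.fourierMultiplierCLM_apply, FourierTransform.fourier_fourierInv_eq,
    SchwartzMap.smulLeftCLM_apply_apply (hφ.hasTemperateGrowth_lpSymbol j), smul_eq_mul]

lemma schwartz_eq_integral (f : 𝓢(Eucl d, ℂ)) (x : Eucl d) :
    f x = ∫ η, Real.fourierChar (inner ℝ η x) • 𝓕 f η := by
  have h : 𝓕⁻ (𝓕 f) = f := FourierTransform.fourierInv_fourier_eq f
  conv_lhs => rw [← h]
  rw [SchwartzMap.fourierInv_coe, Real.fourierInv_eq]

lemma integrable_fourierChar_smul (f : 𝓢(Eucl d, ℂ)) (x : Eucl d) :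
    Integrable fun η => Real.fourierChar (inner ℝ η x) • f η := by
  have h1 : Continuous fun η : Eucl d => Real.fourierChar (inner ℝ η x) :=
    Real.continuous_fourierChar.comp (by fun_prop)
  refine f.integrable.norm.mono' (h1.smul f.continuous).aestronglyMeasurable
    (Eventually.of_forall fun η => ?_)
  simp

lemma sum_lpSchwartz_eq_integral (hφ : IsLPCutoff φ) (f : 𝓢(Eucl d, ℂ)) (s : Finset ℤ)
    (x : Eucl d) :
    ∑ j ∈ s, lpSchwartz φ j f x
      = ∫ η, Real.fourierChar (inner ℝ η x) • ((∑ j ∈ s, lpSymbol φ j η) * 𝓕 f η) := by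
  simp_rw [schwartz_eq_integral (lpSchwartz φ _ f) x]
  rw [← integral_finsetSum _ fun j _ => integrable_fourierChar_smul _ x]
  congr with η
  simp_rw [fourier_lpSchwartz hφ, ← Finset.smul_sum, Finset.sum_mul]

lemma exists_norm_sum_lpSchwartz_le (hφ : IsLPCutoff φ) (f : 𝓢(Eucl d, ℂ)) :
    ∃ B, ∀ (N : ℕ) (x : Eucl d),
      ‖∑ j ∈ Finset.Icc (-(N : ℤ)) N, lpSchwartz φ j f x‖ ≤ B := by
  obtain ⟨M, hM⟩ := exists_norm_sum_lpSymbol_le hφ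
  refine ⟨∫ η, M * ‖𝓕 f η‖, fun N x => ?_⟩
  rw [sum_lpSchwartz_eq_integral hφ]
  refine norm_integral_le_of_norm_le ((𝓕 f).integrable.norm.const_mul M)
    (Eventually.of_forall fun η => ?_)
  rw [Circle.norm_smul, norm_mul]
  gcongr
  exact hM N η

lemma tendsto_sum_lpSchwartz (hφ : IsLPCutoff φ) (hd : 0 < d) (f : 𝓢(Eucl d, ℂ)) (x : Eucl d) :
    Tendsto (fun N : ℕ => ∑ j ∈ Finset.Icc (-(N : ℤ)) N, lpSchwartz φ j f x) atTop
      (𝓝 (f x)) := by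
  obtain ⟨M, hM⟩ := exists_norm_sum_lpSymbol_le hφ
  simp_rw [sum_lpSchwartz_eq_integral hφ]
  rw [schwartz_eq_integral f x]
  refine tendsto_integral_of_dominated_convergence (fun η => M * ‖𝓕 f η‖) (fun N => ?_)
    ((𝓕 f).integrable.norm.const_mul M) (fun N => Eventually.of_forall fun η => ?_) ?_
  · have h1 : Continuous fun η : Eucl d => Real.fourierChar (inner ℝ η x) :=
      Real.continuous_fourierChar.comp (by fun_prop)
    have h2 : ∀ j, Continuous (lpSymbol φ j) := fun j =>
      (hφ.hasTemperateGrowth_lpSymbol j).1.continuous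
    have h3 := (𝓕 f).continuous
    exact (h1.smul ((continuous_finsetSum _ fun j _ => h2 j).mul h3)).aestronglyMeasurable
  · rw [Circle.norm_smul, norm_mul]
    gcongr
    exact hM N η
  · filter_upwards [ae_ne_zero hd] with η hη
    have := ((tendsto_sum_lpSymbol hφ hη).mul_const (𝓕 f η)).const_smul
      (Real.fourierChar (inner ℝ η x))
    simpa using this

lemma tendsto_sum_lpProj_coe (hφ : IsLPCutoff φ) (hd : 0 < d) (f ψ : 𝓢(Eucl d, ℂ)) :
    Tendsto (fun N : ℕ => ∑ j ∈ Finset.Icc (-(N : ℤ)) N, lpProj φ j (f : 𝓢'(Eucl d, ℂ)) ψ) atTop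
      (𝓝 ((f : 𝓢'(Eucl d, ℂ)) ψ)) := by
  obtain ⟨B, hB⟩ := exists_norm_sum_lpSchwartz_le hφ f
  have hi : ∀ j, Integrable fun x => ψ x • lpSchwartz φ j f x := by
    intro j
    obtain ⟨M, hM⟩ := exists_norm_le_schwartz (lpSchwartz φ j f)
    exact ψ.integrable.smul_bdd M (lpSchwartz φ j f).continuous.aestronglyMeasurable
      (Eventually.of_forall hM)
  have h1 : ∀ N : ℕ, ∑ j ∈ Finset.Icc (-(N : ℤ)) N, lpProj φ j (f : 𝓢'(Eucl d, ℂ)) ψ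
      = ∫ x, ψ x • ∑ j ∈ Finset.Icc (-(N : ℤ)) N, lpSchwartz φ j f x := by
    intro N
    simp_rw [lpProj_coe hφ, SchwartzMap.coe_apply, Finset.smul_sum]
    rw [integral_finsetSum _ fun j _ => hi j]
  simp_rw [h1, SchwartzMap.coe_apply]
  refine tendsto_integral_of_dominated_convergence (fun x => ‖ψ x‖ * B) (fun N => ?_)
    (ψ.integrable.norm.mul_const B) (fun N => Eventually.of_forall fun x => ?_)
    (Eventually.of_forall fun x => (tendsto_sum_lpSchwartz hφ hd f x).const_smul _)
  · have h2 := ψ.continuous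
    have h3 : ∀ j, Continuous (lpSchwartz φ j f) := fun j => (lpSchwartz φ j f).continuous
    exact (h2.smul (continuous_finsetSum _ fun j _ => h3 j)).aestronglyMeasurable
  · rw [norm_smul]
    gcongr
    exact hB N x

lemma besovNorm_one {s : ℝ} {p : ℝ≥0∞} [Fact (1 ≤ p)] (u : 𝓢'(Eucl d, ℂ)) :
    besovNorm φ s p 1 u
      = ∑' j : ℤ, (2 : ℝ≥0∞) ^ ((j : ℝ) * s) * distLpNorm p (lpProj φ j u) := by
  rw [besovNorm, eLpNorm_one_eq_lintegral_enorm, lintegral_count]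
  rfl

lemma two_rpow_eq (j : ℤ) (s : ℕ) :
    (2 : ℝ≥0∞) ^ ((j : ℝ) * s) = ENNReal.ofReal (((2 : ℝ) ^ j) ^ s) := by
  rw [← ENNReal.ofReal_ofNat, ENNReal.ofReal_rpow_of_pos (by norm_num), Real.rpow_mul (by norm_num),
    Real.rpow_intCast, Real.rpow_natCast]

lemma distLpNorm_ne_top_of_besovNorm {s : ℝ} {p : ℝ≥0∞} [Fact (1 ≤ p)] {u : 𝓢'(Eucl d, ℂ)}
    (h : besovNorm φ s p 1 u ≠ ⊤) (j : ℤ) : distLpNorm p (lpProj φ j u) ≠ ⊤ := by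
  intro hj
  rw [besovNorm_one] at h
  have := ENNReal.ne_top_of_tsum_ne_top h j
  rw [hj, ENNReal.mul_top] at this
  · exact this rfl
  · exact (ENNReal.rpow_pos (by norm_num) (by norm_num)).ne'

/-- Schwartz decay lets a weighted `L¹` bound control the pairing with any test function, uniformly
in the frequency. -/
lemma exists_enorm_schwartz_le_powWeight (ψ : 𝓢(Eucl d, ℂ)) (s : ℕ) :
    ∃ C : ℝ≥0, ∀ x, x ≠ 0 → ‖ψ x‖ₑ ≤ C * powWeight s x := by
  obtain ⟨C, hC0, hC⟩ := ψ.decay s 0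
  refine ⟨C.toNNReal, fun x hx => ?_⟩
  have hx' : 0 < ‖x‖ := norm_pos_iff.2 hx
  have := hC x
  rw [norm_iteratedFDeriv_zero] at this
  rw [← ofReal_norm, powWeight, Real.enorm_of_nonneg (by positivity), ENNReal.ofNNReal_toNNReal,
    ← ENNReal.ofReal_mul hC0.le]
  apply ENNReal.ofReal_le_ofReal
  rw [mul_one_div, le_div_iff₀ (by positivity), mul_comm]
  exact this

lemma lintegral_schwartz_mul_le (hd : 0 < d) {ψ : 𝓢(Eucl d, ℂ)} {s : ℕ} {C : ℝ≥0}
    (hC : ∀ x, x ≠ 0 → ‖ψ x‖ₑ ≤ C * powWeight s x) (h : Eucl d → ℂ) :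
    ∫⁻ x, ‖ψ x * h x‖ₑ ≤ C * ∫⁻ x, powWeight s x * ‖h x‖ₑ := by
  rw [← lintegral_const_mul' _ _ ENNReal.coe_ne_top]
  refine lintegral_mono_ae ?_
  filter_upwards [ae_ne_zero hd] with x hx
  rw [enorm_mul, ← mul_assoc]
  gcongr
  exact hC x hx

/-- Finiteness of the norm alone would not suffice, since all blocks of a polynomial vanish. The
series converges for the approximating Schwartz functions, and the partial sums paired with `ψ` are
bounded by the Besov norm uniformly in `N`, which allows the two limits to be exchanged. -/
lemma tendsto_sum_lpProj_of_memBesov (hφ : IsLPCutoff φ) (hd : 1 < d) {s : ℕ} (hs : 2 ≤ s)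
    (hs' : s < d) {U : 𝓢'(Eucl d, ℂ)} (hU : MemBesov φ s 1 1 U) (ψ : 𝓢(Eucl d, ℂ)) :
    Tendsto (fun N : ℕ => ∑ j ∈ Finset.Icc (-(N : ℤ)) N, lpProj φ j U ψ) atTop (𝓝 (U ψ)) := by
  obtain ⟨-, f, hf, hfb⟩ := hU
  obtain ⟨C, hC⟩ := exists_isBlock hφ hd hs hs'
  obtain ⟨K, hK⟩ := exists_enorm_schwartz_le_powWeight ψ s
  have hd0 : 0 < d := by omega
  have key : ∀ W : 𝓢'(Eucl d, ℂ), besovNorm φ s 1 1 W ≠ ⊤ → ∀ N : ℕ,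
      ‖∑ j ∈ Finset.Icc (-(N : ℤ)) N, lpProj φ j W ψ‖ₑ
        ≤ (K * C : ℝ≥0∞) * besovNorm φ s 1 1 W := by
    intro W hW N
    have h1 : ∀ j, ‖lpProj φ j W ψ‖ₑ ≤ (K * C : ℝ≥0∞) *
        ((2 : ℝ≥0∞) ^ ((j : ℝ) * s) * distLpNorm 1 (lpProj φ j W)) := by
      intro j
      obtain ⟨h, G₁, G₂, hB⟩ := hC j W (distLpNorm_ne_top_of_besovNorm hW j)
      rw [hB.apply_eq, two_rpow_eq, mul_assoc]
      refine (enorm_integral_le_lintegral_enorm _).trans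
        ((lintegral_schwartz_mul_le hd0 hK h).trans ?_)
      gcongr
      exact hB.bound
    calc _ ≤ ∑ j ∈ Finset.Icc (-(N : ℤ)) N, ‖lpProj φ j W ψ‖ₑ := enorm_sum_le _ _
      _ ≤ ∑ j ∈ Finset.Icc (-(N : ℤ)) N, (K * C : ℝ≥0∞) *
        ((2 : ℝ≥0∞) ^ ((j : ℝ) * s) * distLpNorm 1 (lpProj φ j W)) :=
          Finset.sum_le_sum fun j _ => h1 j
      _ ≤ _ := by
          rw [← Finset.mul_sum, besovNorm_one]
          gcongr
          exact ENNReal.sum_le_tsum _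
  refine TendstoUniformly.tendsto_of_eventually_tendsto (p := (atTop : Filter ℕ))
    (F := fun n (N : ℕ) => ∑ j ∈ Finset.Icc (-(N : ℤ)) N, lpProj φ j (f n : 𝓢'(Eucl d, ℂ)) ψ)
    (L := fun n => (f n : 𝓢'(Eucl d, ℂ)) ψ) ?_
    (Eventually.of_forall fun n => tendsto_sum_lpProj_coe hφ hd0 (f n) ψ)
    (PointwiseConvergenceCLM.tendsto_iff_forall_tendsto.1 hf ψ)
  rw [EMetric.tendstoUniformly_iff]
  intro ε hε
  have h2 : Tendsto (fun n => (K * C : ℝ≥0∞) *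
      besovNorm φ s 1 1 (U - (f n : 𝓢'(Eucl d, ℂ)))) atTop (𝓝 0) := by
    simpa using ENNReal.Tendsto.const_mul hfb (Or.inr (by finiteness : (K * C : ℝ≥0∞) ≠ ⊤))
  filter_upwards [h2.eventually_lt_const hε, hfb.eventually_lt_const ENNReal.zero_lt_top]
    with n hn hn' N
  rw [edist_eq_enorm_sub, ← Finset.sum_sub_distrib]
  refine lt_of_le_of_lt (le_of_eq_of_le ?_ (key _ hn'.ne N)) hn
  congr 1

end

/-! ### Summation of the blocks. -/

section

variable {d : ℕ}

lemma eLpNorm_powWeight (a : ℕ) (f : Eucl d → ℂ) :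
    eLpNorm (fun x => (1 / ‖x‖ ^ a : ℝ) • f x) 1 volume = ∫⁻ x, powWeight a x * ‖f x‖ₑ := by
  rw [eLpNorm_one_eq_lintegral_enorm]
  simp_rw [enorm_smul]
  rfl

lemma enorm_clm_apply_unit_le (L : Eucl d →L[ℝ] ℂ) (x : Eucl d) :
    ‖L (‖x‖⁻¹ • x)‖ₑ ≤ ‖L‖ₑ := by
  refine (ContinuousLinearMap.le_opENorm _ _).trans (mul_le_of_le_one_right' ?_)
  rw [← unitVec_zero, ← ofReal_norm]
  exact ENNReal.ofReal_le_one.2 (norm_unitVec_le 0 x)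

lemma isRadialDeriv_tsum (hd : 0 < d) {f : ℤ → Eucl d → ℂ} {G : ℤ → Eucl d → Eucl d →L[ℝ] ℂ}
    {a b : ℕ} (h : ∀ j, HasWeakGradient (f j) (G j))
    (hf : ∑' j, ∫⁻ x, powWeight a x * ‖f j x‖ₑ ≠ ⊤)
    (hG : ∑' j, ∫⁻ x, powWeight b x * ‖G j x‖ₑ ≠ ⊤) :
    IsRadialDeriv (fun x => ∑' j, f j x) (fun x => ∑' j, G j x (‖x‖⁻¹ • x)) := by
  refine ⟨_, HasWeakGradient.tsum hd h hf hG, ?_⟩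
  filter_upwards [ae_summable_norm_of_powWeight hd
    (fun j => (h j).2.1.aestronglyMeasurable) hG] with x hx
  exact ((ContinuousLinearMap.apply ℝ ℂ (‖x‖⁻¹ • x)).map_tsum hx.of_norm).symm

lemma lintegral_powWeight_radialDeriv_tsum_le {G : ℤ → Eucl d → Eucl d →L[ℝ] ℂ} {a : ℕ}
    (hm : ∀ j, AEStronglyMeasurable (G j)) :
    ∫⁻ x, powWeight a x * ‖∑' j, G j x (‖x‖⁻¹ • x)‖ₑ
      ≤ ∑' j, ∫⁻ x, powWeight a x * ‖G j x‖ₑ := by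
  rw [← lintegral_powWeight_tsum_enorm hm]
  gcongr with x
  exact enorm_tsum_le_tsum_enorm.trans
    (ENNReal.tsum_le_tsum fun j => enorm_clm_apply_unit_le _ _)

lemma eLpNorm_top_pow_smul_tsum_le (hd : 0 < d) {f : ℤ → Eucl d → ℂ} {n : ℕ} {M : ℤ → ℝ≥0∞}
    (hM : ∀ j x, x ≠ 0 → ENNReal.ofReal (‖x‖ ^ n) * ‖f j x‖ₑ ≤ M j) :
    eLpNorm (fun x => ‖x‖ ^ n • ∑' j, f j x) ∞ volume ≤ ∑' j, M j := by
  rw [eLpNorm_exponent_top]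
  refine eLpNormEssSup_le_of_ae_enorm_bound ?_
  filter_upwards [ae_ne_zero hd] with x hx
  rw [enorm_smul, Real.enorm_of_nonneg (by positivity)]
  calc _ ≤ ENNReal.ofReal (‖x‖ ^ n) * ∑' j, ‖f j x‖ₑ := by
        gcongr; exact enorm_tsum_le_tsum_enorm
    _ = ∑' j, ENNReal.ofReal (‖x‖ ^ n) * ‖f j x‖ₑ := ENNReal.tsum_mul_left.symm
    _ ≤ _ := ENNReal.tsum_le_tsum fun j => hM j x hx

namespace IsBlock

variable {s : ℕ}

section single

variable {u : 𝓢'(Eucl d, ℂ)} {B : ℝ≥0∞} {h : Eucl d → ℂ}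
  {G₁ : Eucl d → Eucl d →L[ℝ] ℂ} {G₂ : Eucl d → Eucl d →L[ℝ] Eucl d →L[ℝ] ℂ}

lemma continuous₁ (hb : IsBlock s u B h G₁ G₂) : Continuous G₁ :=
  continuous_iff_continuousAt.2 fun x => (hb.hasFDerivAt' x).continuousAt

lemma continuous₀ (hb : IsBlock s u B h G₁ G₂) : Continuous h :=
  continuous_iff_continuousAt.2 fun x => (hb.hasFDerivAt x).continuousAt

lemma hasWeakGradient (hb : IsBlock s u B h G₁ G₂) : HasWeakGradient h G₁ :=
  hasWeakGradient_of_hasFDerivAt hb.hasFDerivAt hb.continuous₁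

lemma hasWeakGradient' (hb : IsBlock s u B h G₁ G₂) (hd : 0 < d) :
    HasWeakGradient (fun x => G₁ x (‖x‖⁻¹ • x)) (gradRadialDeriv G₁ G₂ 0) :=
  hasWeakGradient_radialDeriv hd hb.hasFDerivAt' hb.continuous hb.finite

/-- The factor `3` is `2 + 1`: twice the first-order bound, from differentiating `x / |x|`, plus the
second-order bound. -/
lemma lintegral_gradRadialDeriv_le (hb : IsBlock 3 u B h G₁ G₂) (hd : 0 < d) :
    ∫⁻ x, powWeight 1 x * ‖gradRadialDeriv G₁ G₂ 0 x‖ₑ ≤ 3 * B := by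
  have hc₁ := hb.continuous₁
  have hm₁ : Measurable fun x => powWeight 2 x * ‖G₁ x‖ₑ :=
    (measurable_powWeight 2).mul hc₁.enorm.measurable
  calc ∫⁻ x, powWeight 1 x * ‖gradRadialDeriv G₁ G₂ 0 x‖ₑ
      ≤ ∫⁻ x, 2 * (powWeight 2 x * ‖G₁ x‖ₑ) + powWeight 1 x * ‖G₂ x‖ₑ := by
        refine lintegral_mono_ae ?_
        filter_upwards [ae_ne_zero hd] with x hx
        have h1 : ‖gradRadialDeriv G₁ G₂ 0 x‖ₑ
            ≤ 2 * (powWeight 1 x * ‖G₁ x‖ₑ) + ‖G₂ x‖ₑ := by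
          have := ENNReal.ofReal_le_ofReal (norm_gradRadialDeriv_le G₁ G₂ 0 hx)
          rw [ENNReal.ofReal_add (by positivity) (by positivity),
            ENNReal.ofReal_mul (by positivity), ENNReal.ofReal_mul (by positivity)] at this
          simpa [powWeight, Real.enorm_of_nonneg] using this
        have h2 : powWeight 2 x = powWeight 1 x * powWeight 1 x := by
          simp only [powWeight]
          rw [← enorm_mul]
          congr 1
          field_simp
        calc _ ≤ powWeight 1 x * (2 * (powWeight 1 x * ‖G₁ x‖ₑ) + ‖G₂ x‖ₑ) := by gcongr
          _ = _ := by rw [h2]; ring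
    _ = 2 * (∫⁻ x, powWeight 2 x * ‖G₁ x‖ₑ) + ∫⁻ x, powWeight 1 x * ‖G₂ x‖ₑ := by
        rw [lintegral_add_left (hm₁.const_mul 2), lintegral_const_mul' _ _ (by simp)]
    _ ≤ 2 * B + B := by
        gcongr
        · exact hb.bound₁
        · exact hb.bound₂
    _ = 3 * B := by ring

end single

variable {u : ℤ → 𝓢'(Eucl d, ℂ)} {B : ℤ → ℝ≥0∞} {h : ℤ → Eucl d → ℂ}
  {G₁ : ℤ → Eucl d → Eucl d →L[ℝ] ℂ} {G₂ : ℤ → Eucl d → Eucl d →L[ℝ] Eucl d →L[ℝ] ℂ}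

lemma tsum_bound (hb : ∀ j, IsBlock s (u j) (B j) (h j) (G₁ j) (G₂ j)) :
    ∑' j, ∫⁻ x, powWeight s x * ‖h j x‖ₑ ≤ ∑' j, B j :=
  ENNReal.tsum_le_tsum fun j => (hb j).bound

lemma tsum_bound₁ (hb : ∀ j, IsBlock s (u j) (B j) (h j) (G₁ j) (G₂ j)) :
    ∑' j, ∫⁻ x, powWeight (s - 1) x * ‖G₁ j x‖ₑ ≤ ∑' j, B j :=
  ENNReal.tsum_le_tsum fun j => (hb j).bound₁

lemma isRepresentedBy_tsum (hd : 0 < d) (hb : ∀ j, IsBlock s (u j) (B j) (h j) (G₁ j) (G₂ j))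
    (hB : ∑' j, B j ≠ ⊤) {U : 𝓢'(Eucl d, ℂ)}
    (hU : ∀ ψ, Tendsto (fun N : ℕ => ∑ j ∈ Finset.Icc (-(N : ℤ)) N, u j ψ) atTop (𝓝 (U ψ))) :
    IsRepresentedBy U (fun x => ∑' j, h j x) := by
  have hfin := ne_top_of_le_ne_top hB (tsum_bound hb)
  have hfin₁ := ne_top_of_le_ne_top hB (tsum_bound₁ hb)
  have hloc := (HasWeakGradient.tsum hd (fun j => (hb j).hasWeakGradient) hfin hfin₁).1
  refine ⟨hloc, fun ψ => ?_⟩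
  obtain ⟨K, hK⟩ := exists_enorm_schwartz_le_powWeight ψ s
  have hle := fun f => lintegral_schwartz_mul_le hd hK f
  have hi : Integrable (fun x => ψ x * ∑' j, h j x) := by
    refine ⟨ψ.continuous.aestronglyMeasurable.mul hloc.aestronglyMeasurable, ?_⟩
    rw [hasFiniteIntegral_iff_enorm]
    refine (hle _).trans_lt (ENNReal.mul_lt_top (by simp) (lt_of_le_of_lt
      (lintegral_powWeight_tsum_le fun j => (hb j).continuous₀.aestronglyMeasurable) hfin.lt_top))
  have hm : ∀ j, AEStronglyMeasurable fun x => ψ x * h j x := fun j =>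
    ψ.continuous.aestronglyMeasurable.mul (hb j).continuous₀.aestronglyMeasurable
  have hsum : ∑' j, ∫⁻ x, ‖ψ x * h j x‖ₑ ≠ ⊤ := by
    refine ne_top_of_le_ne_top (ENNReal.mul_ne_top ENNReal.coe_ne_top hfin)
      ((ENNReal.tsum_le_tsum fun j => hle (h j)).trans_eq ENNReal.tsum_mul_left)
  refine ⟨hi, tendsto_nhds_unique (hU ψ) ?_⟩
  -- Absolute convergence identifies the limit of the same symmetric partial sums as the integral of
  -- the summed function.
  have hs := hasSum_integral_of_summable_integral_norm (μ := (volume : Measure (Eucl d)))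
    (F := fun j x => ψ x * h j x) (fun j => ⟨hm j, ?_⟩) ?_
  · simp_rw [tsum_mul_left] at hs
    simp_rw [fun j => (hb j).apply_eq ψ]
    exact hs.comp Finset.tendsto_Icc_neg
  · exact (ENNReal.ne_top_of_tsum_ne_top hsum j).lt_top
  · refine (ENNReal.summable_toReal hsum).congr fun j => ?_
    rw [integral_norm_eq_lintegral_enorm (hm j)]

end IsBlock

end

/-! ### The `L²` estimate for Schwartz functions. -/

section

open FourierTransform LineDeriv

variable {d : ℕ} {φ : Eucl d → ℂ}

lemma eLpNorm_fourier_two (f : 𝓢(Eucl d, ℂ)) :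
    eLpNorm (𝓕 f : 𝓢(Eucl d, ℂ)) 2 volume = eLpNorm f 2 volume := by
  have h := SchwartzMap.norm_fourier_toL2_eq f
  rw [SchwartzMap.norm_toLp, SchwartzMap.norm_toLp] at h
  exact (ENNReal.toReal_eq_toReal_iff' ((𝓕 f).memLp 2 volume).2.ne (f.memLp 2 volume).2.ne).1 h

/-- Bernstein's inequality through Plancherel: the derivative multiplies by at most `2π |η|`, which
is at most `2 · 2^j` where the symbol is nonzero. -/
lemma eLpNorm_lineDeriv_lpSchwartz_le (hφ : IsLPCutoff φ) (j : ℤ) (f : 𝓢(Eucl d, ℂ))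
    {m : Eucl d} (hm : ‖m‖ = 1) :
    eLpNorm (∂_{m} (lpSchwartz φ j f) : 𝓢(Eucl d, ℂ)) 2 volume
      ≤ ENNReal.ofReal (2 * 2 ^ j) * eLpNorm (lpSchwartz φ j f) 2 volume := by
  rw [← eLpNorm_fourier_two, ← eLpNorm_fourier_two (lpSchwartz φ j f)]
  refine eLpNorm_le_mul_eLpNorm_of_ae_le_mul (Eventually.of_forall fun η => ?_) 2
  have htg : (fun x : Eucl d => inner ℝ x m).HasTemperateGrowth := by fun_prop
  rw [SchwartzMap.fourier_lineDerivOp_eq, smul_apply,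
    SchwartzMap.smulLeftCLM_apply_apply htg, fourier_lpSchwartz hφ]
  rcases lt_or_ge 2 (2 * Real.pi / (2 : ℝ) ^ j * ‖η‖) with h | h
  · simp [lpSymbol_eq_zero hφ h]
  · rw [norm_smul, norm_smul]
    have h1 : ‖(2 * Real.pi * Complex.I : ℂ)‖ = 2 * Real.pi := by
      simp [abs_of_pos Real.pi_pos]
    have h2 : ‖(inner ℝ η m : ℝ)‖ ≤ ‖η‖ := by
      simpa [hm] using norm_inner_le_norm (𝕜 := ℝ) η m
    rw [h1, ← mul_assoc]
    refine mul_le_mul_of_nonneg_right ?_ (norm_nonneg _)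
    rw [div_mul_eq_mul_div, div_le_iff₀ (by positivity)] at h
    calc _ ≤ 2 * Real.pi * ‖η‖ := by gcongr
      _ ≤ _ := h

lemma norm_clm_le_sum (L : Eucl d →L[ℝ] ℂ) :
    ‖L‖ ≤ ∑ i, ‖L (EuclideanSpace.single i 1)‖ := by
  refine ContinuousLinearMap.opNorm_le_bound _ (Finset.sum_nonneg fun _ _ => norm_nonneg _)
    fun v => ?_
  have hv : v = ∑ i, v i • EuclideanSpace.single i (1 : ℝ) := by
    have := (EuclideanSpace.basisFun (Fin d) ℝ).sum_repr v
    simpa using this.symm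
  conv_lhs => rw [hv, map_sum]
  rw [Finset.sum_mul]
  refine (norm_sum_le _ _).trans (Finset.sum_le_sum fun i _ => ?_)
  rw [map_smul, norm_smul, mul_comm]
  gcongr
  exact PiLp.norm_apply_le v i

lemma eLpNorm_fderiv_lpSchwartz_le (hφ : IsLPCutoff φ) (j : ℤ) (f : 𝓢(Eucl d, ℂ)) :
    eLpNorm (fderiv ℝ (lpSchwartz φ j f)) 2 volume
      ≤ ENNReal.ofReal (2 * d * 2 ^ j) * eLpNorm (lpSchwartz φ j f) 2 volume := by
  set F := lpSchwartz φ j f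
  have h1 : eLpNorm (fderiv ℝ F) 2 volume ≤ eLpNorm
      (∑ i : Fin d, fun x => ‖(∂_{EuclideanSpace.single i (1 : ℝ)} F : 𝓢(Eucl d, ℂ)) x‖) 2
      volume := by
    refine eLpNorm_mono_real fun x => ?_
    rw [Finset.sum_apply]
    simp_rw [SchwartzMap.lineDerivOp_apply_eq_fderiv]
    exact norm_clm_le_sum _
  refine h1.trans ((eLpNorm_sum_le (fun i _ => ?_) (by norm_num)).trans ?_)
  · exact (SchwartzMap.continuous _).norm.aestronglyMeasurable
  · simp_rw [eLpNorm_norm]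
    calc _ ≤ ∑ i : Fin d, ENNReal.ofReal (2 * 2 ^ j) * eLpNorm F 2 volume :=
          Finset.sum_le_sum fun i _ => eLpNorm_lineDeriv_lpSchwartz_le hφ j f (by simp)
      _ = _ := by
          rw [Finset.sum_const, Finset.card_univ, Fintype.card_fin, nsmul_eq_mul, ← mul_assoc,
            ← ENNReal.ofReal_natCast, ← ENNReal.ofReal_mul (by positivity)]
          congr 2
          ring

lemma eLpNorm_le_distLpNorm {p : ℝ≥0∞} [Fact (1 ≤ p)] (f : 𝓢(Eucl d, ℂ)) :
    eLpNorm f p volume ≤ distLpNorm p (f : 𝓢'(Eucl d, ℂ)) := by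
  refine le_iInf₂ fun g hg => ?_
  have hker := LinearMap.ker_eq_bot.1 (Lp.ker_toTemperedDistributionCLM_eq_bot (F := ℂ)
    (μ := (volume : Measure (Eucl d))) (p := p))
  have h1 : g = f.toLp p volume := hker (by
    simpa using hg.trans (Lp.toTemperedDistribution_toLp_eq (p := p) f).symm)
  rw [h1, Lp.enorm_def, eLpNorm_congr_ae (f.coeFn_toLp p volume)]

lemma isRadialDistribution_coe {f : 𝓢(Eucl d, ℂ)} (hf : IsRadialFun f) :
    IsRadialDistribution (f : 𝓢'(Eucl d, ℂ)) := by
  intro A ψ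
  rw [SchwartzMap.coe_apply, SchwartzMap.coe_apply]
  have := A.measurePreserving.integral_comp A.toHomeomorph.measurableEmbedding
    (fun z => ψ z • f z)
  rw [← this]
  congr with x
  have h1 : f x = f (A x) := hf _ _ (A.norm_map x).symm
  rw [h1]
  rfl

lemma isRadialFun_lpSchwartz (hφ : IsLPCutoff φ) {f : 𝓢(Eucl d, ℂ)} (hf : IsRadialFun f) (j : ℤ) :
    IsRadialFun (lpSchwartz φ j f) := by
  have := (isRadialDistribution_coe hf).lpProj hφ j
  rw [lpProj_coe hφ] at this
  exact this.isRadialFun (lpSchwartz φ j f).continuous fun ψ => SchwartzMap.coe_apply _ ψ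

lemma exists_radial_lpSchwartz_le (hd : 0 < d) (hφ : IsLPCutoff φ) :
    ∃ C : ℝ≥0, ∀ (f : 𝓢(Eucl d, ℂ)), IsRadialFun f → ∀ (j : ℤ) (x : Eucl d),
      ENNReal.ofReal (‖x‖ ^ (d - 1)) * ‖lpSchwartz φ j f x‖ₑ ^ 2 ≤
        (C * ((2 : ℝ≥0∞) ^ ((j : ℝ) * (1 / 2))
          * distLpNorm 2 (lpProj φ j (f : 𝓢'(Eucl d, ℂ))))) ^ 2 := by
  set c : ℝ≥0∞ := 2 * invSphereArea d * ENNReal.ofReal (2 * d)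
  have hc : c ≠ ⊤ := by
    have := invSphereArea_ne_top hd
    finiteness
  -- The estimate is quadratic; `c ≤ (c + 1)²` avoids a square root of the constant.
  refine ⟨(c + 1).toNNReal, fun f hf j x => ?_⟩
  rw [ENNReal.coe_toNNReal (by finiteness), lpProj_coe hφ]
  set F := lpSchwartz φ j f
  set D := distLpNorm 2 (F : 𝓢'(Eucl d, ℂ))
  have hD : eLpNorm F 2 volume ≤ D := eLpNorm_le_distLpNorm F
  have h1 := (isRadialFun_lpSchwartz hφ hf j).sq_le_eLpNorm_mul hd
    (fun x => F.differentiableAt.hasFDerivAt)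
    ((F.smooth 1).continuous_fderiv (by simp)) (tendsto_cocompact_schwartz F) x
  have h2 : ENNReal.ofReal (2 * d * 2 ^ j) =
      ENNReal.ofReal (2 * d) * ((2 : ℝ≥0∞) ^ ((j : ℝ) * (1 / 2))) ^ 2 := by
    have h := two_rpow_eq j 1
    rw [pow_one, Nat.cast_one, mul_one] at h
    rw [ENNReal.ofReal_mul (by positivity), ← h, ← ENNReal.rpow_natCast, ← ENNReal.rpow_mul]
    congr 2
    push_cast
    ring
  calc _ ≤ 2 * invSphereArea d * (eLpNorm F 2 volume * eLpNorm (fderiv ℝ F) 2 volume) := h1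
    _ ≤ 2 * invSphereArea d * (D * (ENNReal.ofReal (2 * d * 2 ^ j) * D)) := by
        gcongr
        exact (eLpNorm_fderiv_lpSchwartz_le hφ j f).trans (by gcongr)
    _ = c * ((2 : ℝ≥0∞) ^ ((j : ℝ) * (1 / 2)) * D) ^ 2 := by
        rw [h2]; ring
    _ ≤ (c + 1) ^ 2 * ((2 : ℝ≥0∞) ^ ((j : ℝ) * (1 / 2)) * D) ^ 2 := by
        gcongr
        calc c ≤ (c + 1) * 1 := by rw [mul_one]; exact le_self_add
          _ ≤ (c + 1) * (c + 1) := by gcongr; exact le_add_self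
          _ = _ := (sq _).symm
    _ = _ := by ring

lemma exists_radial_schwartz_bound {φ : Eucl 5 → ℂ} (hφ : IsLPCutoff φ) :
    ∃ C : ℝ≥0, ∀ f : 𝓢(Eucl 5, ℂ), IsRadialFun f →
      eLpNorm (fun x => ‖x‖ ^ 2 • f x) ∞ volume
        ≤ C * besovNorm φ (1 / 2) 2 1 (f : 𝓢'(Eucl 5, ℂ)) := by
  obtain ⟨C, hC⟩ := exists_radial_lpSchwartz_le (by norm_num) hφ
  refine ⟨C, fun f hf => ?_⟩
  rw [eLpNorm_exponent_top]
  refine eLpNormEssSup_le_of_ae_enorm_bound (Eventually.of_forall fun x => ?_)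
  rw [enorm_smul, Real.enorm_of_nonneg (by positivity)]
  have hj : ∀ j, ENNReal.ofReal (‖x‖ ^ 2) * ‖lpSchwartz φ j f x‖ₑ ≤
      C * ((2 : ℝ≥0∞) ^ ((j : ℝ) * (1 / 2))
          * distLpNorm 2 (lpProj φ j (f : 𝓢'(Eucl 5, ℂ)))) := by
    intro j
    -- Squaring reduces to the quadratic block bound, as `d - 1 = 4` is twice the exponent `2`.
    rw [← ENNReal.pow_le_pow_left_iff two_ne_zero, mul_pow, ← ENNReal.ofReal_pow (by positivity),
      ← pow_mul]
    exact hC f hf j x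
  have hlim : Tendsto (fun N : ℕ => ENNReal.ofReal (‖x‖ ^ 2) *
      ‖∑ j ∈ Finset.Icc (-(N : ℤ)) N, lpSchwartz φ j f x‖ₑ) atTop
      (𝓝 (ENNReal.ofReal (‖x‖ ^ 2) * ‖f x‖ₑ)) :=
    ENNReal.Tendsto.const_mul
      ((continuous_enorm.tendsto _).comp (tendsto_sum_lpSchwartz hφ (by norm_num) f x))
      (Or.inr ENNReal.ofReal_ne_top)
  refine le_of_tendsto' hlim fun N => ?_
  calc _ ≤ ENNReal.ofReal (‖x‖ ^ 2) *
        ∑ j ∈ Finset.Icc (-(N : ℤ)) N, ‖lpSchwartz φ j f x‖ₑ := by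
        gcongr; exact enorm_sum_le _ _
    _ = ∑ j ∈ Finset.Icc (-(N : ℤ)) N, ENNReal.ofReal (‖x‖ ^ 2) * ‖lpSchwartz φ j f x‖ₑ :=
        Finset.mul_sum _ _ _
    _ ≤ ∑ j ∈ Finset.Icc (-(N : ℤ)) N, C * ((2 : ℝ≥0∞) ^ ((j : ℝ) * (1 / 2))
          * distLpNorm 2 (lpProj φ j (f : 𝓢'(Eucl 5, ℂ)))) := Finset.sum_le_sum fun j _ => hj j
    _ ≤ _ := by
        rw [← Finset.mul_sum, besovNorm_one]
        gcongr
        exact ENNReal.sum_le_tsum _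

/-! ### Assembly of the estimates for radial elements of the Besov spaces. -/

lemma exists_blocks (hφ : IsLPCutoff φ) (hd : 1 < d) {s : ℕ} (hs : 2 ≤ s) (hs' : s < d) :
    ∃ C : ℝ≥0, ∀ U : 𝓢'(Eucl d, ℂ), MemBesov φ s 1 1 U → IsRadialDistribution U →
      ∃ (B : ℤ → ℝ≥0∞) (h : ℤ → Eucl d → ℂ) (G₁ : ℤ → Eucl d → Eucl d →L[ℝ] ℂ)
        (G₂ : ℤ → Eucl d → Eucl d →L[ℝ] Eucl d →L[ℝ] ℂ),
        (∀ j, IsBlock s (lpProj φ j U) (B j) (h j) (G₁ j) (G₂ j)) ∧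
        (∀ j, IsRadialFun (h j)) ∧ ∑' j, B j = C * besovNorm φ s 1 1 U ∧ ∑' j, B j ≠ ⊤ ∧
        IsRepresentedBy U (fun x => ∑' j, h j x) := by
  obtain ⟨C, hC⟩ := exists_isBlock hφ hd hs hs'
  refine ⟨C, fun U hU hr => ?_⟩
  choose h G₁ G₂ hb using fun j => hC j U (distLpNorm_ne_top_of_besovNorm hU.1.ne j)
  have hsum : ∑' j : ℤ, (C * (ENNReal.ofReal (((2 : ℝ) ^ j) ^ s) * distLpNorm 1 (lpProj φ j U)))
      = C * besovNorm φ s 1 1 U := by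
    rw [ENNReal.tsum_mul_left, besovNorm_one]
    simp_rw [two_rpow_eq]
  have hfin : C * besovNorm φ s 1 1 U ≠ ⊤ := ENNReal.mul_ne_top ENNReal.coe_ne_top hU.1.ne
  exact ⟨_, h, G₁, G₂, hb,
    fun j => (hr.lpProj hφ j).isRadialFun (hb j).continuous₀ (hb j).apply_eq, hsum,
    hsum ▸ hfin, IsBlock.isRepresentedBy_tsum (by omega) hb (hsum ▸ hfin)
      (tendsto_sum_lpProj_of_memBesov hφ hd hs hs' hU)⟩

lemma exists_radial_besov_two_bound {φ : Eucl 5 → ℂ} (hφ : IsLPCutoff φ) :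
    ∃ C : ℝ≥0, ∀ U₁ : 𝓢'(Eucl 5, ℂ), MemBesov φ 2 1 1 U₁ → IsRadialDistribution U₁ →
        ∃ u₁ dru₁ : Eucl 5 → ℂ,
          IsRepresentedBy U₁ u₁ ∧ IsRadialDeriv u₁ dru₁ ∧
          eLpNorm (fun x => (1 / ‖x‖) • dru₁ x) 1 volume
            + eLpNorm (fun x => (1 / ‖x‖ ^ 2) • u₁ x) 1 volume
            + eLpNorm (fun x => ‖x‖ ^ 3 • u₁ x) ∞ volume
            ≤ C * besovNorm φ 2 1 1 U₁ := by
  obtain ⟨C, hC⟩ := exists_blocks hφ (by norm_num) (le_refl 2) (by norm_num)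
  have hA := invSphereArea_ne_top (d := 5) (by norm_num)
  -- Each of the two `L¹` terms costs one sum of block bounds; the supremum costs `invSphereArea 5`
  -- such sums.
  refine ⟨(2 + (invSphereArea 5).toNNReal) * C, fun U hU hr => ?_⟩
  obtain ⟨B, h, G₁, G₂, hb, hrad, hsum, hfin, hrep⟩ := hC U (by exact_mod_cast hU) hr
  have hb₁ := IsBlock.tsum_bound₁ hb
  refine ⟨_, _, hrep, isRadialDeriv_tsum (by norm_num) (fun j => (hb j).hasWeakGradient)
    (ne_top_of_le_ne_top hfin (IsBlock.tsum_bound hb)) (ne_top_of_le_ne_top hfin hb₁), ?_⟩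
  have hpow : ∀ x : Eucl 5, 1 / ‖x‖ = 1 / ‖x‖ ^ 1 := fun x => by rw [pow_one]
  simp_rw [hpow]
  rw [eLpNorm_powWeight, eLpNorm_powWeight]
  calc _ ≤ ∑' j, B j + ∑' j, B j + ∑' j, invSphereArea 5 * B j := by
        gcongr ?_ + ?_ + ?_
        · exact (lintegral_powWeight_radialDeriv_tsum_le fun j =>
            (hb j).continuous₁.aestronglyMeasurable).trans hb₁
        · exact (lintegral_powWeight_tsum_le fun j =>
            (hb j).continuous₀.aestronglyMeasurable).trans (IsBlock.tsum_bound hb)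
        · refine eLpNorm_top_pow_smul_tsum_le (n := 3) (by norm_num) fun j x _ => ?_
          refine (IsRadialFun.pow_mul_enorm_le (d := 5) (h := h j) (G₁ := G₁ j) (by norm_num)
            (hrad j) (hb j).hasFDerivAt (hb j).continuous₁ (hb j).tendsto x).trans ?_
          gcongr
          exact (hb j).bound₁
    _ = _ := by
        rw [ENNReal.tsum_mul_left, hsum]
        push_cast
        rw [ENNReal.coe_toNNReal hA]
        ring

lemma exists_radial_besov_three_bound {φ : Eucl 5 → ℂ} (hφ : IsLPCutoff φ) :
    ∃ C : ℝ≥0, ∀ U₀ : 𝓢'(Eucl 5, ℂ), MemBesov φ 3 1 1 U₀ → IsRadialDistribution U₀ →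
        ∃ u₀ dru₀ drru₀ : Eucl 5 → ℂ,
          IsRepresentedBy U₀ u₀ ∧ IsRadialDeriv u₀ dru₀ ∧ IsRadialDeriv dru₀ drru₀ ∧
          eLpNorm (fun x => (1 / ‖x‖ ^ 2) • dru₀ x) 1 volume
            + eLpNorm (fun x => (1 / ‖x‖) • drru₀ x) 1 volume
            + eLpNorm (fun x => (1 / ‖x‖ ^ 3) • u₀ x) 1 volume
            + eLpNorm (fun x => ‖x‖ ^ 3 • dru₀ x) ∞ volume
            ≤ C * besovNorm φ 3 1 1 U₀ := by
  obtain ⟨C, hC⟩ := exists_blocks hφ (by norm_num) (by norm_num : 2 ≤ 3) (by norm_num)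
  have hA := invSphereArea_ne_top (d := 5) (by norm_num)
  -- Here `5 = 1 + 3 + 1`, the middle term being the second radial derivative.
  refine ⟨(5 + (invSphereArea 5).toNNReal) * C, fun U hU hr => ?_⟩
  obtain ⟨B, h, G₁, G₂, hb, hrad, hsum, hfin, hrep⟩ := hC U (by exact_mod_cast hU) hr
  have hwg := fun j => (hb j).hasWeakGradient' (by norm_num)
  have hb₁ := IsBlock.tsum_bound₁ hb
  have hdr : ∑' j, ∫⁻ x, powWeight 2 x * ‖G₁ j x (‖x‖⁻¹ • x)‖ₑ ≤ ∑' j, B j :=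
    (ENNReal.tsum_le_tsum fun j => lintegral_mono fun x =>
      mul_le_mul_right (enorm_clm_apply_unit_le _ _) _).trans hb₁
  have hdrr : ∑' j, ∫⁻ x, powWeight 1 x * ‖gradRadialDeriv (G₁ j) (G₂ j) 0 x‖ₑ
      ≤ 3 * ∑' j, B j := by
    rw [← ENNReal.tsum_mul_left]
    exact ENNReal.tsum_le_tsum fun j => (hb j).lintegral_gradRadialDeriv_le (by norm_num)
  -- The witnesses are the series of the blocks, of their radial derivatives and of their second
  -- radial derivatives; the series lemma is applied once to the blocks and once to their radial
  -- derivatives.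
  refine ⟨_, _, _, hrep, isRadialDeriv_tsum (by norm_num) (fun j => (hb j).hasWeakGradient)
    (ne_top_of_le_ne_top hfin (IsBlock.tsum_bound hb)) (ne_top_of_le_ne_top hfin hb₁),
    isRadialDeriv_tsum (by norm_num) hwg (ne_top_of_le_ne_top hfin hdr)
      (ne_top_of_le_ne_top (ENNReal.mul_ne_top (by simp) hfin) hdrr), ?_⟩
  have hpow : ∀ x : Eucl 5, 1 / ‖x‖ = 1 / ‖x‖ ^ 1 := fun x => by rw [pow_one]
  simp_rw [hpow]
  rw [eLpNorm_powWeight, eLpNorm_powWeight, eLpNorm_powWeight]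
  calc _ ≤ ∑' j, B j + 3 * ∑' j, B j + ∑' j, B j + ∑' j, invSphereArea 5 * B j := by
        gcongr ?_ + ?_ + ?_ + ?_
        · exact (lintegral_powWeight_radialDeriv_tsum_le fun j =>
            (hb j).continuous₁.aestronglyMeasurable).trans hb₁
        · exact (lintegral_powWeight_radialDeriv_tsum_le fun j =>
            (hwg j).2.1.aestronglyMeasurable).trans hdrr
        · exact (lintegral_powWeight_tsum_le fun j =>
            (hb j).continuous₀.aestronglyMeasurable).trans (IsBlock.tsum_bound hb)
        · refine eLpNorm_top_pow_smul_tsum_le (by norm_num) fun j x hx => ?_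
          refine ((hrad j).pow_mul_enorm_radialDeriv_le (by norm_num) (hb j).hasFDerivAt
            (hb j).hasFDerivAt' (hb j).continuous (hb j).tendsto' hx).trans ?_
          gcongr
          exact (hb j).bound₂
    _ = _ := by
        rw [ENNReal.tsum_mul_left, hsum]
        push_cast
        rw [ENNReal.coe_toNNReal hA]
        ring

end

end

theorem lemma2p2 (φ : Eucl 5 → ℂ) (hφ : IsLPCutoff φ) :
    ∃ C : ℝ≥0,
      (∀ f : 𝓢(Eucl 5, ℂ), IsRadialFun f →
        eLpNorm (fun x => ‖x‖ ^ 2 • f x) ∞ volume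
          ≤ C * besovNorm φ (1 / 2) 2 1 (f : 𝓢'(Eucl 5, ℂ))) ∧
      (∀ U₀ : 𝓢'(Eucl 5, ℂ), MemBesov φ 3 1 1 U₀ → IsRadialDistribution U₀ →
        ∃ u₀ dru₀ drru₀ : Eucl 5 → ℂ,
          IsRepresentedBy U₀ u₀ ∧ IsRadialDeriv u₀ dru₀ ∧ IsRadialDeriv dru₀ drru₀ ∧
          eLpNorm (fun x => (1 / ‖x‖ ^ 2) • dru₀ x) 1 volume
            + eLpNorm (fun x => (1 / ‖x‖) • drru₀ x) 1 volume
            + eLpNorm (fun x => (1 / ‖x‖ ^ 3) • u₀ x) 1 volume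
            + eLpNorm (fun x => ‖x‖ ^ 3 • dru₀ x) ∞ volume
            ≤ C * besovNorm φ 3 1 1 U₀) ∧
      (∀ U₁ : 𝓢'(Eucl 5, ℂ), MemBesov φ 2 1 1 U₁ → IsRadialDistribution U₁ →
        ∃ u₁ dru₁ : Eucl 5 → ℂ,
          IsRepresentedBy U₁ u₁ ∧ IsRadialDeriv u₁ dru₁ ∧
          eLpNorm (fun x => (1 / ‖x‖) • dru₁ x) 1 volume
            + eLpNorm (fun x => (1 / ‖x‖ ^ 2) • u₁ x) 1 volume
            + eLpNorm (fun x => ‖x‖ ^ 3 • u₁ x) ∞ volume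
            ≤ C * besovNorm φ 2 1 1 U₁) := by
  obtain ⟨C₁, h₁⟩ := exists_radial_schwartz_bound hφ
  obtain ⟨C₂, h₂⟩ := exists_radial_besov_three_bound hφ
  obtain ⟨C₃, h₃⟩ := exists_radial_besov_two_bound hφ
  have hle₁ : (C₁ : ℝ≥0∞) ≤ ((C₁ + C₂ + C₃ : ℝ≥0) : ℝ≥0∞) := by
    rw [add_assoc]; exact_mod_cast le_self_add
  have hle₂ : (C₂ : ℝ≥0∞) ≤ ((C₁ + C₂ + C₃ : ℝ≥0) : ℝ≥0∞) := by
    rw [add_comm C₁, add_assoc]; exact_mod_cast le_self_add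
  have hle₃ : (C₃ : ℝ≥0∞) ≤ ((C₁ + C₂ + C₃ : ℝ≥0) : ℝ≥0∞) := by
    exact_mod_cast le_add_self
  refine ⟨C₁ + C₂ + C₃, fun f hf => (h₁ f hf).trans (by gcongr), fun U hU hr => ?_,
    fun U hU hr => ?_⟩
  · obtain ⟨u, v, w, hu, hv, hw, hle⟩ := h₂ U hU hr
    exact ⟨u, v, w, hu, hv, hw, hle.trans (by gcongr)⟩
  · obtain ⟨u, v, hu, hv, hle⟩ := h₃ U hU hr
    exact ⟨u, v, hu, hv, hle.trans (by gcongr)⟩
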